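/- **2-groups.** A 2-group $\mathbb G$ is a monoidal category (product $\otimes$, unit $I$, associator $a$, unit constraints $l,r$) in which every morphism is invertible and, for every object $A$, the functors $A\otimes -$ and $-\otimes A$ are equivalences. Let $\pi_0(\mathbb G)$ be the group of isomorphism classes of objects, with unit $e=[I]$, and let $\pi_1(\mathbb G)=\mathrm{Aut}(I)$, an abelian group. For an object $A$, the maps $\gamma_A(u)=l_A\circ(u\otimes \mathrm{id}_A)\circ l_A^{-1}$ and $\delta_A(u)=r_A\circ(\mathrm{id}_A\otimes u)\circ r_A^{-1}$ are isomorphisms $\pi_1(\mathbb G)\to\mathrm{Aut}(A)$, and $\pi_1(\mathbb G)$ is a $\pi_0(\mathbb G)$-module by $[A]\cdot u=\gamma_A^{-1}(\delta_A(u))$. A *choice* $D$ consists of a representative $A_g$ of each $g\in\pi_0(\mathbb G)$, with $A_e=I$, and isomorphisms $\iota_{g,h}:A_g\otimes A_h\to A_{gh}$ with $\iota_{e,g}=l_{A_g}$ and $\iota_{g,e}=r_{A_g}$. It defines a normalized 3-cocycle $\alpha_D(g,h,k)=\gamma_{A_{ghk}}^{-1}\big(\iota_{g,hk}\circ(\mathrm{id}\otimes\iota_{h,k})\circ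 a\circ(\iota_{g,h}^{-1}\otimes\mathrm{id})\circ\iota_{gh,k}^{-1}\big)$ of $\pi_0(\mathbb G)$ with values in $\pi_1(\mathbb G)$. A *classifying 3-cocycle* of $\mathbb G$ is a 3-cochain of the form $\alpha_D+\partial b$, with $D$ a choice and $b$ a normalized 2-cochain. **2-matrices.** $\mathbf{2Mat}_{\mathbb C}$ is the following strict 2-category. Its objects are the natural numbers $n\ge 0$. A 1-morphism $(\mathbf R,\mathbf s):n\to m$ is an $m\times n$ matrix $\mathbf R$ of natural numbers together with invertible complex matrices $\mathbf s_i(a)$ of order $\mathbf R(a)_i$, for $1\le i\le m$ and $a\in\mathbb N^n$, such that $\mathbf s_i(e_j)$ is an identity for all $j$; here $e_j$ is the $j$-th basis vector. A 2-morphism $\mathsf T:(\mathbf R,\mathbf s)\Rightarrow(\mathbf R',\mathbf s')$ consists of complex $R'_{ij}\times R_{ij}$ matrices $\mathsf T_{ij}$, and vertical composition is entrywise matrix multiplication. The composite of $(\mathbf R,\mathbf s):n\to m$ and $(\mathbf S,\mathbf t):m\to p$ is $(\mathbf S\mathbf R,\mathbf t*\mathbf s)$ with $$(\mathbf t*\mathbf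 s)_k(a)=\mathbf t_k(\mathbf R(a))\Big(\bigoplus_i I_{S_{ki}}\otimes\mathbf s_i(a)\Big)P\Big(\bigoplus_j\mathbf t_k(\mathbf R(e_j))^{-1}\otimes I_{a_j}\Big),$$ where $P$ is the permutation matrix of the reordering of multi-indices $(j,((i,s,t),p))\mapsto(i,(s,(j,t,p)))$ (with $s\le S_{ki}$, $t\le R_{ij}$, $p\le a_j$; all multi-indices in lexicographic order). Horizontal composition of $\mathsf T:(\mathbf R,\mathbf s)\Rightarrow(\mathbf R',\mathbf s')$ and $\mathsf U:(\mathbf S,\mathbf t)\Rightarrow(\mathbf S',\mathbf t')$ is $$(\mathsf U\circ\mathsf T)_{kj}=\mathbf t'_k(\mathbf R'(e_j))\Big(\bigoplus_i\mathsf U_{ki}\otimes\mathsf T_{ij}\Big)\mathbf t_k(\mathbf R(e_j))^{-1}.$$ Write $\mathbf P(\sigma)$ for the matrix $P(\sigma)_{ij}=\delta_{i,\sigma(j)}$ and $\mathbf I$ for the gauge consisting of identity matrices. **Representations.** A representation $\mathbb F$ of $\mathbb G$ on $\mathbf{2Mat}_{\mathbb C}$ is a pseudofunctor to $\mathbf{2Mat}_{\mathbb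 C}$ from the one-object bicategory defined by $\mathbb G$ (1-morphisms the objects of $\mathbb G$, 2-morphisms the morphisms of $\mathbb G$, and $B\circ A=B\otimes A$). Its dimension $n$ is the image of the unique object; it is nonzero if $n\ge 1$. Two representations are equivalent if they are equivalent objects of the bicategory of pseudofunctors, pseudonatural transformations and modifications. **Quadruples.** Let $S_n$ act on $(\mathbb C^*)^n$ by $(\sigma\cdot\lambda)_i=\lambda_{\sigma^{-1}(i)}$; for a homomorphism $\rho:\pi_0(\mathbb G)\to S_n$ let $(\mathbb C^*)^n_\rho$ be the resulting $\pi_0(\mathbb G)$-module. Given a classifying 3-cocycle $\alpha$, consider quadruples $(n,\rho,\beta,c)$ with $n\ge 1$, $\rho:\pi_0(\mathbb G)\to S_n$ a homomorphism, $\beta:\pi_1(\mathbb G)\to(\mathbb C^*)^n_\rho$ a morphism of $\pi_0(\mathbb G)$-modules with $[\beta\circ\alpha]=0$ in $H^3(\pi_0(\mathbb G),(\mathbb C^*)^n_\rho)$, and $c$ a normalized 2-cochain of $\pi_0(\mathbb G)$ with values in $(\mathbb C^*)^n_\rho$ such that $\partial c=\beta\circ\alpha$. Two quadruples $(n,\rho,\beta,c)$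 and $(n',\rho',\beta',c')$ are equivalent if $n=n'$ and there are $\sigma\in S_n$ and a normalized 1-cochain $x$ with values in $(\mathbb C^*)^n_{\rho'}$ such that $\rho'(g)=\sigma\rho(g)\sigma^{-1}$ for all $g$, $\beta'(u)=\sigma\cdot\beta(u)$ for all $u$, and $c'=\sigma\cdot c+\partial x$. **Theorem.** Let $\mathbb G$ be a 2-group and $\alpha$ a classifying 3-cocycle of $\mathbb G$. Then there is a choice $D=(A_g,\iota_{g,h})$ with $\alpha_D=\alpha$. For every such choice and every quadruple $(n,\rho,\beta,c)$ there is an $n$-dimensional representation $\mathbb F$ such that, for all $g,h\in\pi_0(\mathbb G)$, $\varphi\in\mathrm{Aut}(A_g)$ and $1\le j\le n$, $$\mathbb F(A_g)=(\mathbf P(\rho(g)),\mathbf I),\qquad \mathbb F(\varphi)_{\rho(g)(j),j}=\beta(\gamma_{A_g}^{-1}(\varphi))_{\rho(g)(j)},\qquad \big(\mathbb F(\iota_{g,h})\circ\mathbb F_2(A_g,A_h)\big)_{\rho(gh)(j),j}=c(g,h)_{\rho(gh)(j)},$$ where $\mathbb F_2(A_g,A_h):\mathbb F(A_g)\circ\mathbb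 F(A_h)\Rightarrow\mathbb F(A_g\otimes A_h)$ is the structural isomorphism of $\mathbb F$. Sending the class of $(n,\rho,\beta,c)$ to the class of any such $\mathbb F$ is a well-defined bijection from the set of equivalence classes of quadruples $(n,\rho,\beta,c)$ onto the set of equivalence classes of nonzero representations of $\mathbb G$ on $\mathbf{2Mat}_{\mathbb C}$. -/

import Mathlib

open CategoryTheory

universe v u

noncomputable section

/-- Objects of the 2-category `2Mat_ℂ` of complex 2-matrices: natural numbers `n ≥ 0`. -/
structure TwoMat : Type where
  dim : ℕ

namespace TwoMat

open Matrix Kronecker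

section BlockMatrices

variable {m n : ℕ}

/-- Lexicographic numbering of the rows of a block matrix `⨁ⱼ (Tⱼ ⊗ Mⱼ)`, where `Tⱼ` has `r j`
rows and `Mⱼ` has `a j` rows. -/
def lex (r a : Fin n → ℕ) : (Σ j, Fin (r j) × Fin (a j)) ≃ Fin (r ⬝ᵥ a) :=
  (Equiv.sigmaCongrRight fun _ => finProdFinEquiv).trans finSigmaFinEquiv

/-- The block diagonal matrix `⨁ⱼ (Tⱼ ⊗ Mⱼ)` (Kronecker products), rows and columns in
lexicographic order. -/
def tensorSum {r r' a b : Fin n → ℕ} (T : ∀ j, Matrix (Fin (r' j)) (Fin (r j)) ℂ)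
    (M : ∀ j, Matrix (Fin (b j)) (Fin (a j)) ℂ) : Matrix (Fin (r' ⬝ᵥ b)) (Fin (r ⬝ᵥ a)) ℂ :=
  (blockDiagonal' fun j => T j ⊗ₖ M j).submatrix (lex r' b).symm (lex r a).symm

lemma tensorSum_mul {r r' r'' a b d : Fin n → ℕ}
    (T' : ∀ j, Matrix (Fin (r'' j)) (Fin (r' j)) ℂ)
    (T : ∀ j, Matrix (Fin (r' j)) (Fin (r j)) ℂ)
    (M' : ∀ j, Matrix (Fin (d j)) (Fin (b j)) ℂ)
    (M : ∀ j, Matrix (Fin (b j)) (Fin (a j)) ℂ) :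
    tensorSum T' M' * tensorSum T M =
      tensorSum (fun j => T' j * T j) (fun j => M' j * M j) := by
  simp only [tensorSum, submatrix_mul_equiv, ← blockDiagonal'_mul, mul_kronecker_mul]

lemma tensorSum_one {r a : Fin n → ℕ} :
    tensorSum (fun j => (1 : Matrix (Fin (r j)) (Fin (r j)) ℂ))
      (fun j => (1 : Matrix (Fin (a j)) (Fin (a j)) ℂ)) = 1 := by
  simp only [tensorSum, one_kronecker_one]
  rw [show (fun j => (1 : Matrix (Fin (r j) × Fin (a j)) (Fin (r j) × Fin (a j)) ℂ)) = 1 from rfl,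
    blockDiagonal'_one, submatrix_one_equiv]

/-- The product `R(a)` of a matrix `R` of natural numbers and a vector `a` of natural numbers. -/
abbrev rankVec (R : Fin m → Fin n → ℕ) (a : Fin n → ℕ) : Fin m → ℕ := fun i => R i ⬝ᵥ a

/-- The product of two matrices of natural numbers. Its `j`-th column is `Q` applied to the `j`-th
column `R(eⱼ)` of `R`. -/
abbrev rankMul {p : ℕ} (Q : Fin p → Fin m → ℕ) (R : Fin m → Fin n → ℕ) : Fin p → Fin n → ℕ :=
  fun k j => Q k ⬝ᵥ fun i => R i j

/-- The bijection of multi-indices `(j, ((i, s, t), p)) ↦ (i, (s, (j, t, p)))`. -/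
def reassoc (r : Fin m → ℕ) (R : Fin m → Fin n → ℕ) (a : Fin n → ℕ) :
    (Σ j, (Σ i, Fin (r i) × Fin (R i j)) × Fin (a j)) ≃
      (Σ i, Fin (r i) × (Σ j, Fin (R i j) × Fin (a j))) where
  toFun x := ⟨x.2.1.1, x.2.1.2.1, x.1, x.2.1.2.2, x.2.2⟩
  invFun y := ⟨y.2.2.1, ⟨y.1, y.2.1, y.2.2.2.1⟩, y.2.2.2.2⟩
  left_inv _ := rfl
  right_inv _ := rfl

/-- The permutation underlying `perm`: `reassoc` with all multi-indices numbered
lexicographically. -/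
def permEquiv (r : Fin m → ℕ) (R : Fin m → Fin n → ℕ) (a : Fin n → ℕ) :
    Fin ((fun j => r ⬝ᵥ fun i => R i j) ⬝ᵥ a) ≃ Fin (r ⬝ᵥ rankVec R a) :=
  (lex (fun j => r ⬝ᵥ fun i => R i j) a).symm.trans <|
    (Equiv.sigmaCongrRight fun j =>
      (lex r fun i => R i j).symm.prodCongr (Equiv.refl (Fin (a j)))).trans <|
    (reassoc r R a).trans <|
    (Equiv.sigmaCongrRight fun i =>
      (Equiv.refl (Fin (r i))).prodCongr (lex (R i) a)).trans <|
    lex r (rankVec R a)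

lemma permEquiv_lex (r : Fin m → ℕ) (R : Fin m → Fin n → ℕ) (a : Fin n → ℕ)
    (j : Fin n) (i : Fin m) (s : Fin (r i)) (t : Fin (R i j)) (p : Fin (a j)) :
    permEquiv r R a (lex (fun j => r ⬝ᵥ fun i => R i j) a
      ⟨j, lex r (fun i => R i j) ⟨i, s, t⟩, p⟩) =
      lex r (rankVec R a) ⟨i, s, lex (R i) a ⟨j, t, p⟩⟩ := by
  simp [permEquiv, reassoc]

/-- The permutation matrix `P(r, R, a)` of order `∑ i j, r i * R i j * a j` in the composition of
1-morphisms of `2Mat_ℂ`; it intertwines `⨁ᵢ (Uᵢ ⊗ ⨁ⱼ (Tᵢⱼ ⊗ Mⱼ))` and `⨁ⱼ ((⨁ᵢ Uᵢ ⊗ Tᵢⱼ) ⊗ Mⱼ)`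
(see `tensorSum_mul_perm`). It is the identity (for the evident identification of the sizes) if
`r` is a basis vector, if `a` is a basis vector, if `R` is an identity matrix, and if `R` has
a single column. -/
def perm (r : Fin m → ℕ) (R : Fin m → Fin n → ℕ) (a : Fin n → ℕ) :
    Matrix (Fin (r ⬝ᵥ rankVec R a)) (Fin ((fun j => r ⬝ᵥ fun i => R i j) ⬝ᵥ a)) ℂ :=
  Matrix.of fun x y => if x = permEquiv r R a y then 1 else 0

lemma perm_eq (r : Fin m → ℕ) (R : Fin m → Fin n → ℕ) (a : Fin n → ℕ) :
    perm r R a = (1 : Matrix (Fin (r ⬝ᵥ rankVec R a)) (Fin (r ⬝ᵥ rankVec R a)) ℂ).submatrix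
      (Equiv.refl _) (permEquiv r R a) := by
  ext x y; simp [perm, Matrix.one_apply]

lemma perm_transpose_eq (r : Fin m → ℕ) (R : Fin m → Fin n → ℕ) (a : Fin n → ℕ) :
    (perm r R a)ᵀ = (1 : Matrix (Fin (r ⬝ᵥ rankVec R a)) (Fin (r ⬝ᵥ rankVec R a)) ℂ).submatrix
      (permEquiv r R a) (Equiv.refl _) := by
  rw [perm_eq, transpose_submatrix, transpose_one]

lemma perm_mul_transpose (r : Fin m → ℕ) (R : Fin m → Fin n → ℕ) (a : Fin n → ℕ) :
    perm r R a * (perm r R a)ᵀ = 1 := by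
  rw [perm_transpose_eq, perm_eq, submatrix_mul_equiv, one_mul, submatrix_one_equiv]

lemma perm_transpose_mul (r : Fin m → ℕ) (R : Fin m → Fin n → ℕ) (a : Fin n → ℕ) :
    (perm r R a)ᵀ * perm r R a = 1 := by
  rw [perm_transpose_eq, perm_eq, submatrix_mul_equiv, one_mul, submatrix_one_equiv]

lemma tensorSum_lex {r r' a b : Fin n → ℕ} (T : ∀ j, Matrix (Fin (r' j)) (Fin (r j)) ℂ)
    (M : ∀ j, Matrix (Fin (b j)) (Fin (a j)) ℂ) (j j' : Fin n) (s : Fin (r' j)) (p : Fin (b j))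
    (s' : Fin (r j')) (p' : Fin (a j')) :
    tensorSum T M (lex r' b ⟨j, s, p⟩) (lex r a ⟨j', s', p'⟩) =
      if h : j' = j then T j s (h ▸ s') * M j p (h ▸ p') else 0 := by
  simp only [tensorSum, submatrix_apply, Equiv.symm_apply_apply]
  by_cases h : j' = j
  · subst h; simp [blockDiagonal'_apply_eq]
  · simp [blockDiagonal'_apply_ne _ _ _ (Ne.symm h), h]

lemma tensorSum_mul_perm {r r' : Fin m → ℕ} {R R' : Fin m → Fin n → ℕ}
    {a b : Fin n → ℕ} (U : ∀ i, Matrix (Fin (r' i)) (Fin (r i)) ℂ)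
    (T : ∀ i j, Matrix (Fin (R' i j)) (Fin (R i j)) ℂ)
    (M : ∀ j, Matrix (Fin (b j)) (Fin (a j)) ℂ) :
    tensorSum U (b := rankVec R' b) (a := rankVec R a) (fun i => tensorSum (T i) M) *
        perm r R a =
      perm r' R' b * tensorSum (r' := fun j => r' ⬝ᵥ fun i => R' i j)
        (r := fun j => r ⬝ᵥ fun i => R i j)
        (fun j => tensorSum U fun i => T i j) M := by
  have h1 : ∀ X : Matrix (Fin (r' ⬝ᵥ rankVec R' b)) (Fin (r ⬝ᵥ rankVec R a)) ℂ,
      X * perm r R a = X.submatrix id (permEquiv r R a) := by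
    intro X
    ext x y
    simp [perm, Matrix.mul_apply]
  have h2 : ∀ Y : Matrix (Fin ((fun j => r' ⬝ᵥ fun i => R' i j) ⬝ᵥ b))
      (Fin ((fun j => r ⬝ᵥ fun i => R i j) ⬝ᵥ a)) ℂ,
      perm r' R' b * Y = Y.submatrix (permEquiv r' R' b).symm id := by
    intro X
    ext x y
    simp [perm, Matrix.mul_apply, ← Equiv.symm_apply_eq]
  rw [h1, h2]
  ext x y
  obtain ⟨x, rfl⟩ := (permEquiv r' R' b).surjective x
  obtain ⟨⟨j, x1, p⟩, rfl⟩ := (lex _ _).surjective x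
  obtain ⟨⟨i, s, t⟩, rfl⟩ := (lex _ _).surjective x1
  obtain ⟨⟨j', y1, p'⟩, rfl⟩ := (lex _ _).surjective y
  obtain ⟨⟨i', s', t'⟩, rfl⟩ := (lex _ _).surjective y1
  simp only [submatrix_apply, Equiv.symm_apply_apply, id]
  rw [permEquiv_lex, permEquiv_lex, tensorSum_lex, tensorSum_lex]
  by_cases hi : i' = i <;> by_cases hj : j' = j
  · subst hi hj
    simp only [dite_true, tensorSum_lex]
    ring
  · subst hi
    simp [hj, tensorSum_lex]
  · subst hj
    simp [hi, tensorSum_lex]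
  · simp [hj, hi]

lemma mul_cancel_mid {a b c d : ℕ} (X : Matrix (Fin a) (Fin b) ℂ) (Y : Matrix (Fin b) (Fin c) ℂ)
    (Z : Matrix (Fin c) (Fin b) ℂ) (W : Matrix (Fin b) (Fin d) ℂ) (h : Y * Z = 1) :
    X * Y * (Z * W) = X * W := by
  rw [Matrix.mul_assoc, ← Matrix.mul_assoc Y, h, Matrix.one_mul]

variable {p : ℕ}

/-- The gauge `S ∗ s` of a composite:
`(S ∗ s)(a) = S(R(a)) · (⨁ᵢ I_{rᵢ} ⊗ sᵢ(a)) · P(r, R, a) · (⨁ⱼ S(R(eⱼ))⁻¹ ⊗ I_{aⱼ})`.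
Here `r` and `S` are one row of the second 1-morphism and the corresponding component of its
gauge. Rows and columns are numbered by two (provably equal) natural numbers. -/
def compGaugeAux (r : Fin m → ℕ) (R : Fin m → Fin n → ℕ)
    (S : ∀ a : Fin m → ℕ, GL (Fin (r ⬝ᵥ a)) ℂ)
    (s : ∀ (i : Fin m) (a : Fin n → ℕ), GL (Fin (R i ⬝ᵥ a)) ℂ) (a : Fin n → ℕ) :
    Matrix (Fin (r ⬝ᵥ rankVec R a)) (Fin ((fun j => r ⬝ᵥ fun i => R i j) ⬝ᵥ a)) ℂ :=
  (S (rankVec R a)).1 *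
    tensorSum (r := r) (r' := r) (a := rankVec R a) (b := rankVec R a)
      (fun _ => 1) (fun i => (s i a).1) *
    perm r R a *
    tensorSum (r := fun j => r ⬝ᵥ fun i => R i j) (r' := fun j => r ⬝ᵥ fun i => R i j)
      (a := a) (b := a) (fun j => (S fun i => R i j)⁻¹.1) (fun _ => 1)

/-- The inverse of `compGaugeAux`. -/
def compGaugeInvAux (r : Fin m → ℕ) (R : Fin m → Fin n → ℕ)
    (S : ∀ a : Fin m → ℕ, GL (Fin (r ⬝ᵥ a)) ℂ)
    (s : ∀ (i : Fin m) (a : Fin n → ℕ), GL (Fin (R i ⬝ᵥ a)) ℂ) (a : Fin n → ℕ) :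
    Matrix (Fin ((fun j => r ⬝ᵥ fun i => R i j) ⬝ᵥ a)) (Fin (r ⬝ᵥ rankVec R a)) ℂ :=
  tensorSum (r := fun j => r ⬝ᵥ fun i => R i j) (r' := fun j => r ⬝ᵥ fun i => R i j)
      (a := a) (b := a) (fun j => (S fun i => R i j).1) (fun _ => 1) *
    (perm r R a)ᵀ *
    tensorSum (r := r) (r' := r) (a := rankVec R a) (b := rankVec R a)
      (fun _ => 1) (fun i => (s i a)⁻¹.1) *
    (S (rankVec R a))⁻¹.1

section

variable (r : Fin m → ℕ) (R : Fin m → Fin n → ℕ)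
    (S : ∀ a : Fin m → ℕ, GL (Fin (r ⬝ᵥ a)) ℂ)
    (s : ∀ (i : Fin m) (a : Fin n → ℕ), GL (Fin (R i ⬝ᵥ a)) ℂ) (a : Fin n → ℕ)

lemma gl_mul_inv {q : ℕ} (g : GL (Fin q) ℂ) : g.1 * g⁻¹.1 = 1 := Units.mul_inv g

lemma gl_inv_mul {q : ℕ} (g : GL (Fin q) ℂ) : g⁻¹.1 * g.1 = 1 := Units.inv_mul g

lemma compGaugeAux_mul : compGaugeAux r R S s a * compGaugeInvAux r R S s a = 1 := by
  simp only [compGaugeAux, compGaugeInvAux, Matrix.mul_assoc]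
  rw [← Matrix.mul_assoc (tensorSum _ _) (tensorSum _ _), tensorSum_mul]
  simp only [gl_inv_mul, Matrix.mul_one, tensorSum_one, Matrix.one_mul]
  rw [← Matrix.mul_assoc (perm _ _ _), perm_mul_transpose, Matrix.one_mul,
    ← Matrix.mul_assoc (tensorSum _ _) (tensorSum _ _), tensorSum_mul]
  simp only [gl_mul_inv, Matrix.mul_one, tensorSum_one, Matrix.one_mul]

lemma compGaugeInvAux_mul : compGaugeInvAux r R S s a * compGaugeAux r R S s a = 1 := by
  simp only [compGaugeAux, compGaugeInvAux, Matrix.mul_assoc]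
  rw [← Matrix.mul_assoc (S _)⁻¹.1, gl_inv_mul, Matrix.one_mul,
    ← Matrix.mul_assoc (tensorSum _ _) (tensorSum _ _), tensorSum_mul]
  simp only [gl_inv_mul, Matrix.mul_one, tensorSum_one, Matrix.one_mul]
  rw [← Matrix.mul_assoc (perm _ _ _)ᵀ, perm_transpose_mul, Matrix.one_mul, tensorSum_mul]
  simp only [gl_mul_inv, Matrix.mul_one, tensorSum_one]

end

/-- Conjugation with composite gauges is iterated conjugation. -/
lemma compGaugeAux_conj {r r' : Fin m → ℕ} {R R' : Fin m → Fin n → ℕ}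
    (S : ∀ a : Fin m → ℕ, GL (Fin (r ⬝ᵥ a)) ℂ)
    (S' : ∀ a : Fin m → ℕ, GL (Fin (r' ⬝ᵥ a)) ℂ)
    (s : ∀ (i : Fin m) (a : Fin n → ℕ), GL (Fin (R i ⬝ᵥ a)) ℂ)
    (s' : ∀ (i : Fin m) (a : Fin n → ℕ), GL (Fin (R' i ⬝ᵥ a)) ℂ)
    {a b : Fin n → ℕ} (U : ∀ i, Matrix (Fin (r' i)) (Fin (r i)) ℂ)
    (T : ∀ i j, Matrix (Fin (R' i j)) (Fin (R i j)) ℂ)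
    (M : ∀ j, Matrix (Fin (b j)) (Fin (a j)) ℂ) :
    compGaugeAux r' R' S' s' b *
        tensorSum (r' := fun j => r' ⬝ᵥ fun i => R' i j) (r := fun j => r ⬝ᵥ fun i => R i j)
          (fun j => (S' fun i => R' i j).1 * (tensorSum U fun i => T i j) *
            (S fun i => R i j)⁻¹.1) M *
        compGaugeInvAux r R S s a =
      (S' (rankVec R' b)).1 *
        tensorSum (b := rankVec R' b) (a := rankVec R a) U
          (fun i => (s' i b).1 * tensorSum (T i) M * (s i a)⁻¹.1) *
        (S (rankVec R a))⁻¹.1 := by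
  have key := tensorSum_mul_perm U T M
  simp only [compGaugeAux, compGaugeInvAux, Matrix.mul_assoc]
  rw [← Matrix.mul_assoc (tensorSum _ _) (tensorSum _ _), tensorSum_mul]
  simp only [← Matrix.mul_assoc, gl_inv_mul, Matrix.one_mul]
  congr 1
  simp only [Matrix.mul_assoc]
  congr 1
  rw [← Matrix.mul_assoc (tensorSum _ M), tensorSum_mul]
  simp only [Matrix.mul_assoc, gl_inv_mul, Matrix.mul_one]
  rw [← Matrix.mul_assoc (perm r' R' b), ← key]
  simp only [← Matrix.mul_assoc]
  rw [Matrix.mul_assoc _ (perm r R a), perm_mul_transpose, Matrix.mul_one, tensorSum_mul,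
    tensorSum_mul]
  simp only [Matrix.one_mul, Matrix.mul_one, Matrix.mul_assoc]

end BlockMatrices

section Normalization

variable {m n : ℕ}

lemma dotProduct_rankVec (r : Fin m → ℕ) (R : Fin m → Fin n → ℕ) (a : Fin n → ℕ) :
    r ⬝ᵥ rankVec R a = (fun j => r ⬝ᵥ fun i => R i j) ⬝ᵥ a :=
  (Fin.equiv_iff_eq.1 ⟨permEquiv r R a⟩).symm

lemma dotProduct_single' (r : Fin n → ℕ) (j : Fin n) : r ⬝ᵥ Pi.single j 1 = r j := by simp

lemma lex_val (r a : Fin n → ℕ) (j : Fin n) (s : Fin (r j)) (p : Fin (a j))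
    (h : ∀ i < j, r i * a i = 0) : (lex r a ⟨j, s, p⟩ : ℕ) = p + a j * s := by
  refine (finSigmaFinEquiv_apply (n := fun j => r j * a j)
    ⟨j, finProdFinEquiv (s, p)⟩).trans ?_
  rw [finProdFinEquiv_apply_val, Finset.sum_eq_zero, zero_add]
  intro i _
  exact h _ (by rw [Fin.lt_def]; exact i.2)

lemma lex_single (r : Fin n → ℕ) (j : Fin n) (s : Fin (r j))
    (p : Fin ((Pi.single j 1 : Fin n → ℕ) j)) :
    lex r (Pi.single j 1) ⟨j, s, p⟩ = Fin.cast (dotProduct_single' r j).symm s := by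
  apply Fin.ext
  rw [lex_val _ _ _ _ _ (fun i hi => by simp [hi.ne])]
  have hp : (p : ℕ) < 1 := by simpa using p.2
  simp [Nat.lt_one_iff.1 hp]

lemma exists_lex_single (r : Fin n → ℕ) (j : Fin n) (x : Fin (r ⬝ᵥ Pi.single j 1)) :
    x = lex r (Pi.single j 1) ⟨j, Fin.cast (dotProduct_single' r j) x,
      ⟨0, by simp⟩⟩ := by
  rw [lex_single]; rfl

lemma tensorSum_single {r r' : Fin n → ℕ} (T : ∀ j, Matrix (Fin (r' j)) (Fin (r j)) ℂ)
    (j : Fin n) :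
    tensorSum T (a := Pi.single j 1) (b := Pi.single j 1) (fun _ => 1) =
      (T j).submatrix (Fin.cast (dotProduct_single' r' j)) (Fin.cast (dotProduct_single' r j)) := by
  ext x y
  conv_lhs => rw [exists_lex_single r' j x, exists_lex_single r j y, tensorSum_lex]
  simp

lemma permEquiv_single_symm (r : Fin m → ℕ) (R : Fin m → Fin n → ℕ) (j : Fin n)
    (x : Fin (r ⬝ᵥ rankVec R (Pi.single j 1))) :
    (permEquiv r R (Pi.single j 1)).symm x =
      Fin.cast (dotProduct_rankVec r R (Pi.single j 1)) x := by
  rw [Equiv.symm_apply_eq]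
  generalize hy : Fin.cast (dotProduct_rankVec r R (Pi.single j 1)) x = y
  have hy' : (x : ℕ) = y := by rw [← hy]; rfl
  rw [exists_lex_single _ j y]
  obtain ⟨⟨i, s, t⟩, hz⟩ := (lex r fun i => R i j).surjective
    (Fin.cast (dotProduct_single' (fun j => r ⬝ᵥ fun i => R i j) j) y)
  rw [← hz, permEquiv_lex]
  apply Fin.ext
  rw [hy']
  have hz' : (y : ℕ) = lex r (fun i => R i j) ⟨i, s, t⟩ := by rw [hz]; rfl
  rw [hz', lex_single]
  have e : (fun i => R i j) = rankVec R (Pi.single j 1) := by funext i; simp [rankVec]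
  have gen : ∀ (v w : Fin m → ℕ) (h : v = w) (t : Fin (v i)),
      (lex r v ⟨i, s, t⟩ : ℕ) = lex r w ⟨i, s, Fin.cast (congrFun h i) t⟩ := by
    rintro v _ rfl t; rfl
  exact gen _ _ e t

lemma compGaugeAux_single (r : Fin m → ℕ) (R : Fin m → Fin n → ℕ)
    (S : ∀ a : Fin m → ℕ, GL (Fin (r ⬝ᵥ a)) ℂ)
    (s : ∀ (i : Fin m) (a : Fin n → ℕ), GL (Fin (R i ⬝ᵥ a)) ℂ) (j : Fin n)
    (hs : ∀ i, s i (Pi.single j 1) = 1) :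
    (compGaugeAux r R S s (Pi.single j 1)).submatrix
      (finCongr (dotProduct_rankVec r R (Pi.single j 1)).symm) (Equiv.refl _) = 1 := by
  have h2 : ∀ Y : Matrix (Fin ((fun j => r ⬝ᵥ fun i => R i j) ⬝ᵥ Pi.single j 1))
      (Fin ((fun j => r ⬝ᵥ fun i => R i j) ⬝ᵥ Pi.single j 1)) ℂ,
      perm r R (Pi.single j 1) * Y =
        Y.submatrix (Fin.cast (dotProduct_rankVec r R (Pi.single j 1))) id := by
    intro X
    ext x y
    simp [perm, Matrix.mul_apply, ← Equiv.symm_apply_eq, permEquiv_single_symm]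
  have e : (fun i => R i j) = rankVec R (Pi.single j 1) := by funext i; simp [rankVec]
  simp only [compGaugeAux, hs, Units.val_one, tensorSum_one, Matrix.mul_one]
  rw [Matrix.mul_assoc, h2, tensorSum_single, submatrix_submatrix]
  have gen : ∀ (v w : Fin m → ℕ) (_ : w = v) (N : ℕ) (hN : N = r ⬝ᵥ v) (hN' : r ⬝ᵥ v = r ⬝ᵥ w)
      (hN'' : N = r ⬝ᵥ w),
      ((S v).1 * (S w)⁻¹.1.submatrix (Fin.cast hN') (Fin.cast hN'')).submatrix
        (Fin.cast hN) id = 1 := by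
    rintro v w rfl N rfl _ _
    exact gl_mul_inv (S w)
  exact gen _ _ e _ (dotProduct_rankVec r R (Pi.single j 1)).symm (by rw [← e])
    ((dotProduct_rankVec r R (Pi.single j 1)).symm.trans (by rw [← e]))

end Normalization

/-- 1-morphisms `(R, s) : n → m` of `2Mat_ℂ`: an `m × n` matrix `R` of natural numbers (the rank
matrix) and, for every `i` and every `a ∈ ℕⁿ`, an invertible complex matrix `sᵢ(a)` of order
`R(a)ᵢ` (the gauge) such that `sᵢ(eⱼ)` is the identity. Here `GL` of an empty index type is
trivial, so that there is exactly one 1-morphism if `n = 0` or `m = 0`. -/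
structure Hom (n m : TwoMat) : Type where
  rank : Fin m.dim → Fin n.dim → ℕ
  gauge (i : Fin m.dim) (a : Fin n.dim → ℕ) : GL (Fin (rank i ⬝ᵥ a)) ℂ
  gauge_single (i : Fin m.dim) (j : Fin n.dim) : gauge i (Pi.single j 1) = 1

/-- 2-morphisms `(R, s) ⇒ (R', s')`: matrices whose `(i, j)` entry is an `R'ᵢⱼ × Rᵢⱼ` complex matrix
(empty if `Rᵢⱼ = 0` or `R'ᵢⱼ = 0`). -/
def Hom₂ {n m : TwoMat} (f g : Hom n m) : Type :=
  ∀ (i : Fin m.dim) (j : Fin n.dim), Matrix (Fin (g.rank i j)) (Fin (f.rank i j)) ℂ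

/-- Vertical composition is entrywise multiplication of matrices; a product through an empty matrix
is the zero matrix. -/
instance (n m : TwoMat) : Category (Hom n m) where
  Hom f g := Hom₂ f g
  id _ := fun _ _ => 1
  comp T T' := fun i j => T' i j * T i j
  id_comp T := by funext i j; exact Matrix.mul_one _
  comp_id T := by funext i j; exact Matrix.one_mul _
  assoc T T' T'' := by funext i j; exact (Matrix.mul_assoc _ _ _).symm

/-- The identity 1-morphism: identity rank matrix and trivial gauge. -/
def Hom.id (n : TwoMat) : Hom n n where
  rank i j := if i = j then 1 else 0
  gauge _ _ := 1
  gauge_single _ _ := rfl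

/-- The composite `g ∘ f`, first `f : n → m`, then `g : m → p`: its rank matrix is the product of
the rank matrices, its gauge is `compGaugeAux` up to the identification of the two equal sizes. -/
def Hom.comp {n m p : TwoMat} (f : Hom n m) (g : Hom m p) : Hom n p where
  rank := rankMul g.rank f.rank
  gauge k a :=
    { val := (compGaugeAux (g.rank k) f.rank (g.gauge k) f.gauge a).submatrix
        (finCongr (dotProduct_rankVec (g.rank k) f.rank a).symm) (Equiv.refl _)
      inv := (compGaugeInvAux (g.rank k) f.rank (g.gauge k) f.gauge a).submatrix (Equiv.refl _)
        (finCongr (dotProduct_rankVec (g.rank k) f.rank a).symm)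
      val_inv := by
        rw [submatrix_mul_equiv, compGaugeAux_mul, submatrix_one_equiv]
      inv_val := by
        rw [submatrix_mul_equiv, compGaugeInvAux_mul, submatrix_one_equiv] }
  gauge_single k j :=
    Units.ext (compGaugeAux_single _ _ _ _ _ fun i => f.gauge_single i j)

/-- For a 2-morphism `T : (R, s) ⇒ (R', s')` and matrices `Mⱼ` of size `bⱼ × aⱼ`, the `R'(b)ᵢ × R(a)ᵢ`
matrices `s'ᵢ(b) · (⨁ⱼ Tᵢⱼ ⊗ Mⱼ) · sᵢ(a)⁻¹`. -/
def applyMat {n m : TwoMat} {f g : Hom n m} (T : Hom₂ f g) {a b : Fin n.dim → ℕ}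
    (M : ∀ j, Matrix (Fin (b j)) (Fin (a j)) ℂ) (i : Fin m.dim) :
    Matrix (Fin (rankVec g.rank b i)) (Fin (rankVec f.rank a i)) ℂ :=
  (g.gauge i b).1 * tensorSum (T i) M * (f.gauge i a)⁻¹.1

/-- Horizontal composition of 2-morphisms,
`(U ∘ T)ₖⱼ = s'ₖ(R'(eⱼ)) · (⨁ᵢ Uₖᵢ ⊗ Tᵢⱼ) · sₖ(R(eⱼ))⁻¹`, where `s`, `s'` are the gauges of the source
and target of `U` and `R`, `R'` are the rank matrices of the source and target of `T`. -/
def hcomp {n m p : TwoMat} {f f' : Hom n m} {g g' : Hom m p} (U : Hom₂ g g') (T : Hom₂ f f') :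
    Hom₂ (f.comp g) (f'.comp g') := fun k j =>
  applyMat U (a := fun i => f.rank i j) (b := fun i => f'.rank i j) (fun i => T i j) k

section Laws

variable {n m p q : TwoMat}

lemma applyMat_mul {f g h : Hom n m} (T : f ⟶ g) (T' : g ⟶ h)
    {a b d : Fin n.dim → ℕ} (M : ∀ j, Matrix (Fin (b j)) (Fin (a j)) ℂ)
    (M' : ∀ j, Matrix (Fin (d j)) (Fin (b j)) ℂ) (i : Fin m.dim) :
    applyMat (T ≫ T' : f ⟶ h) (fun j => M' j * M j) i = applyMat T' M' i * applyMat T M i := by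
  have : tensorSum ((T ≫ T') i) (fun j => M' j * M j) = tensorSum (T' i) M' * tensorSum (T i) M :=
    (tensorSum_mul _ _ _ _).symm
  simp only [applyMat, this, Matrix.mul_assoc]
  rw [← Matrix.mul_assoc (g.gauge i b)⁻¹.1, gl_inv_mul, Matrix.one_mul]

lemma applyMat_one (f : Hom n m) (a : Fin n.dim → ℕ) (i : Fin m.dim) :
    applyMat (𝟙 f) (a := a) (b := a) (fun _ => 1) i = 1 := by
  have : tensorSum ((𝟙 f : f ⟶ f) i) (fun j => (1 : Matrix (Fin (a j)) (Fin (a j)) ℂ)) = 1 :=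
    tensorSum_one
  simp only [applyMat, this, Matrix.mul_one, gl_mul_inv]

/-- Transport of a family of matrices along equalities of their sizes. -/
def castMat {k : ℕ} {a a' b b' : Fin k → ℕ} (ha : a = a') (hb : b = b')
    (M : ∀ j, Matrix (Fin (b j)) (Fin (a j)) ℂ) (j : Fin k) :
    Matrix (Fin (b' j)) (Fin (a' j)) ℂ :=
  (M j).submatrix (Fin.cast (congrFun hb j).symm) (Fin.cast (congrFun ha j).symm)

lemma rankVec_rankMul (f : Hom n m) (g : Hom m p) (a : Fin n.dim → ℕ) :
    rankVec g.rank (rankVec f.rank a) = rankVec (f.comp g).rank a := by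
  funext k; exact dotProduct_rankVec _ _ _

lemma applyMat_hcomp {f f' : Hom n m} {g g' : Hom m p} (U : Hom₂ g g') (T : Hom₂ f f')
    {a b : Fin n.dim → ℕ} (M : ∀ j, Matrix (Fin (b j)) (Fin (a j)) ℂ) :
    applyMat (hcomp U T) M = castMat (rankVec_rankMul f g a) (rankVec_rankMul f' g' b)
      (applyMat U (applyMat T M)) := by
  funext k
  have := compGaugeAux_conj (g.gauge k) (g'.gauge k) f.gauge f'.gauge (U k) T M
  simp only [castMat]
  have h2 : applyMat U (applyMat T M) k = _ := this.symm
  rw [h2]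
  change ((compGaugeAux _ _ _ _ _).submatrix _ _) * _ * ((compGaugeInvAux _ _ _ _ _).submatrix _ _)
    = _
  rfl

lemma applyMat_castMat {f g : Hom n m} (T : Hom₂ f g) {a a' b b' : Fin n.dim → ℕ}
    (ha : a = a') (hb : b = b') (M : ∀ j, Matrix (Fin (b j)) (Fin (a j)) ℂ) :
    applyMat T (castMat ha hb M) = castMat (by rw [ha]) (by rw [hb]) (applyMat T M) := by
  subst ha hb; rfl

lemma castMat_castMat {k : ℕ} {a a' a'' b b' b'' : Fin k → ℕ} (ha : a = a') (hb : b = b')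
    (ha' : a' = a'') (hb' : b' = b'') (M : ∀ j, Matrix (Fin (b j)) (Fin (a j)) ℂ) :
    castMat ha' hb' (castMat ha hb M) = castMat (ha.trans ha') (hb.trans hb') M := rfl

/-- The gauge can be read off from the action on the inclusions of basis vectors. -/
lemma gauge_eq (f : Hom n m) (i : Fin m.dim) (a : Fin n.dim → ℕ) (x : Fin (f.rank i ⬝ᵥ a))
    (j : Fin n.dim) (t : Fin (f.rank i j)) (p : Fin (a j)) :
    (f.gauge i a).1 x (lex (f.rank i) a ⟨j, t, p⟩) =
      applyMat (𝟙 f) (a := Pi.single j 1) (b := a)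
        (fun j' => Matrix.of fun p' _ => if (⟨j', p'⟩ : Σ j, Fin (a j)) = ⟨j, p⟩ then 1 else 0)
        i x (Fin.cast (dotProduct_single' (f.rank i) j).symm t) := by
  simp only [applyMat, f.gauge_single, inv_one, Units.val_one, Matrix.mul_one]
  rw [Matrix.mul_apply, ← lex_single (f.rank i) j t ⟨0, by simp⟩,
    ← Equiv.sum_comp (lex (f.rank i) a), Finset.sum_eq_single ⟨j, t, p⟩]
  · rw [tensorSum_lex]
    have e : (𝟙 f : f ⟶ f) i j t t = 1 := Matrix.one_apply_eq t
    simp only [dite_true, Matrix.of_apply, if_true, mul_one, e]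
  · rintro ⟨j', t', p'⟩ - hne
    rw [tensorSum_lex]
    split_ifs with h
    · subst h
      by_cases hp : p' = p
      · subst hp
        have : t' ≠ t := by rintro rfl; exact hne rfl
        have e : (𝟙 f : f ⟶ f) i j t' t = 0 := Matrix.one_apply_ne this
        simp [e]
      · simp [hp]
    · simp
  · simp

lemma Hom.ext_of_applyMat {f g : Hom n m} (h : f.rank = g.rank)
    (H : ∀ (a b : Fin n.dim → ℕ) (M : ∀ j, Matrix (Fin (b j)) (Fin (a j)) ℂ),
      applyMat (𝟙 f) M = castMat (by rw [h]) (by rw [h]) (applyMat (𝟙 g) M)) : f = g := by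
  obtain ⟨R, s, hs⟩ := f
  obtain ⟨R', s', hs'⟩ := g
  obtain rfl : R = R' := h
  congr 1
  funext i a
  ext x y
  obtain ⟨⟨j, t, p⟩, rfl⟩ := (lex (R i) a).surjective y
  have h1 := gauge_eq ⟨R, s, hs⟩ i a x j t p
  have h2 := gauge_eq ⟨R, s', hs'⟩ i a x j t p
  refine h1.trans (Eq.trans ?_ h2.symm)
  rw [H]; rfl

lemma rankVec_id (a : Fin n.dim → ℕ) : rankVec (Hom.id n).rank a = a := by
  funext i; simp [rankVec, Hom.id, dotProduct]

lemma id_index (i : Fin n.dim) (a : Fin n.dim → ℕ) (x : Fin ((Hom.id n).rank i ⬝ᵥ a)) :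
    x = lex ((Hom.id n).rank i) a
      ⟨i, ⟨0, by simp [Hom.id]⟩, Fin.cast (congrFun (rankVec_id a) i) x⟩ := by
  apply Fin.ext
  rw [lex_val]
  · simp
  · intro j hj
    simp [Hom.id, hj.ne']

lemma applyMat_id {a b : Fin n.dim → ℕ} (M : ∀ j, Matrix (Fin (b j)) (Fin (a j)) ℂ) :
    applyMat (𝟙 (Hom.id n)) M = castMat (rankVec_id a).symm (rankVec_id b).symm M := by
  funext i
  ext x y
  simp only [applyMat, castMat]
  have h1 : ((Hom.id n).gauge i b).1 = 1 := rfl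
  have h2 : ((Hom.id n).gauge i a)⁻¹.1 = 1 := by
    rw [show (Hom.id n).gauge i a = 1 from rfl, inv_one]; rfl
  rw [h1, h2, Matrix.one_mul, Matrix.mul_one]
  conv_lhs => rw [id_index i b x, id_index i a y, tensorSum_lex]
  have e : ∀ s, (𝟙 (Hom.id n) : Hom.id n ⟶ Hom.id n) i i s s = 1 := fun s => Matrix.one_apply_eq s
  simp only [dite_true, e, one_mul]
  rfl

lemma applyMat_single {f g : Hom n m} (T : Hom₂ f g) {a : Fin n.dim → ℕ} (j : Fin n.dim)
    (h : a = Pi.single j 1) (i : Fin m.dim) :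
    applyMat T (a := a) (b := a) (fun _ => 1) i =
      (T i j).submatrix (Fin.cast (by rw [rankVec, h, dotProduct_single']))
        (Fin.cast (by rw [rankVec, h, dotProduct_single'])) := by
  subst h
  simp only [applyMat, Hom.gauge_single, inv_one, Units.val_one, Matrix.mul_one, Matrix.one_mul,
    tensorSum_single]

lemma hcomp_id_comp_id (f : Hom n m) (g : Hom m p) : hcomp (𝟙 g) (𝟙 f) = 𝟙 (f.comp g) := by
  funext k j; exact applyMat_one g _ k

lemma hcomp_comp {f f' f'' : Hom n m} {g g' g'' : Hom m p} (T : f ⟶ f') (T' : f' ⟶ f'')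
    (U : g ⟶ g') (U' : g' ⟶ g'') :
    hcomp (U ≫ U') (T ≫ T') = (show f.comp g ⟶ f'.comp g' from hcomp U T) ≫
      (show f'.comp g' ⟶ f''.comp g'' from hcomp U' T') := by
  funext k j
  exact applyMat_mul U U' (fun i => T i j) (fun i => T' i j) k

lemma applyMat_id_hcomp (f : Hom n m) (g : Hom m p)
    {a b : Fin n.dim → ℕ} (M : ∀ j, Matrix (Fin (b j)) (Fin (a j)) ℂ) :
    applyMat (𝟙 (f.comp g)) M = castMat (rankVec_rankMul f g a) (rankVec_rankMul f g b)
      (applyMat (𝟙 g) (applyMat (𝟙 f) M)) := by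
  rw [← applyMat_hcomp, hcomp_id_comp_id]

lemma Hom.comp_assoc (f : Hom n m) (g : Hom m p) (h : Hom p q) :
    (f.comp g).comp h = f.comp (g.comp h) := by
  refine Hom.ext_of_applyMat ?_ fun a b M => ?_
  · funext l j
    exact congrFun (rankVec_rankMul g h fun i => f.rank i j) l
  · rw [applyMat_id_hcomp, applyMat_id_hcomp f g, applyMat_castMat, applyMat_id_hcomp f,
      applyMat_id_hcomp g h]
    rfl

lemma Hom.id_comp (f : Hom n m) : (Hom.id n).comp f = f := by
  refine Hom.ext_of_applyMat ?_ fun a b M => ?_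
  · funext i j
    simp [Hom.comp, Hom.id, rankMul, dotProduct]
  · rw [applyMat_id_hcomp, applyMat_id, applyMat_castMat]
    rfl

lemma Hom.comp_id (f : Hom n m) : f.comp (Hom.id m) = f := by
  refine Hom.ext_of_applyMat ?_ fun a b M => ?_
  · funext i j
    simp [Hom.comp, Hom.id, rankMul, dotProduct]
  · rw [applyMat_id_hcomp, applyMat_id]
    rfl

lemma rank_congr {f g : Hom n m} (h : f = g) (i : Fin m.dim) (j : Fin n.dim) :
    f.rank i j = g.rank i j := by rw [h]

lemma eqToHom_conj {f f' g g' : Hom n m} (hf : f = f') (hg : g' = g) (T : f' ⟶ g') :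
    eqToHom hf ≫ T ≫ eqToHom hg = (fun i j => (T i j).submatrix
      (Fin.cast (rank_congr hg i j).symm) (Fin.cast (rank_congr hf i j)) : Hom₂ f g) := by
  subst hf hg
  simp only [eqToHom_refl, Category.id_comp, Category.comp_id]
  rfl

lemma hcomp_id_left {f f' : Hom n m} (T : f ⟶ f') :
    hcomp T (𝟙 (Hom.id n)) =
      eqToHom (Hom.id_comp f) ≫ T ≫ eqToHom (Hom.id_comp f').symm := by
  rw [eqToHom_conj]
  funext i j
  have h : (fun i => (Hom.id n).rank i j) = Pi.single j 1 := by
    funext i; simp [Hom.id, Pi.single_apply]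
  exact applyMat_single T j h i

lemma hcomp_id_right {f f' : Hom n m} (T : f ⟶ f') :
    hcomp (𝟙 (Hom.id m)) T =
      eqToHom (Hom.comp_id f) ≫ T ≫ eqToHom (Hom.comp_id f').symm := by
  rw [eqToHom_conj]
  funext i j
  exact congrFun (applyMat_id fun i => T i j) i

lemma hcomp_assoc {f f' : Hom n m} {g g' : Hom m p} {h h' : Hom p q} (T : f ⟶ f') (U : g ⟶ g')
    (V : h ⟶ h') :
    hcomp (hcomp V U) T = eqToHom (Hom.comp_assoc f g h).symm ≫
      (show (f.comp g).comp h ⟶ (f'.comp g').comp h' from hcomp V (hcomp U T)) ≫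
      eqToHom (Hom.comp_assoc f' g' h') := by
  rw [eqToHom_conj]
  funext l j
  exact congrFun (applyMat_hcomp V U fun i => T i j) l

lemma conj_cancel {f f' g g' : Hom n m} (hf : f = f') (hg : g = g') (T : f ⟶ g) :
    eqToHom hf ≫ (eqToHom hf.symm ≫ T ≫ eqToHom hg) ≫ eqToHom hg.symm = T := by
  subst hf hg; simp

lemma hcomp_eqToHom_left (f : Hom n m) {g g' : Hom m p} (h : g = g') :
    hcomp (eqToHom h) (𝟙 f) = eqToHom (congrArg f.comp h) := by
  subst h; exact hcomp_id_comp_id f g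

lemma hcomp_eqToHom_right {f f' : Hom n m} (h : f = f') (g : Hom m p) :
    hcomp (𝟙 g) (eqToHom h) = eqToHom (congrArg (fun x => Hom.comp x g) h) := by
  subst h; exact hcomp_id_comp_id f g

end Laws

/-- The 2-category `2Mat_ℂ`. -/
instance bicategory : Bicategory TwoMat where
  Hom := Hom
  id := Hom.id
  comp f g := f.comp g
  whiskerLeft f _ _ T := hcomp T (𝟙 f)
  whiskerRight T g := hcomp (𝟙 g) T
  associator f g h := eqToIso (Hom.comp_assoc f g h)
  leftUnitor f := eqToIso (Hom.id_comp f)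
  rightUnitor f := eqToIso (Hom.comp_id f)
  whiskerLeft_id f g := hcomp_id_comp_id f g
  whiskerLeft_comp f _ _ _ T U := by
    have := hcomp_comp (𝟙 f) (𝟙 f) T U
    rwa [Category.comp_id] at this
  id_whiskerLeft T := hcomp_id_left T
  comp_whiskerLeft f g _ _ T := by
    have := hcomp_assoc (𝟙 f) (𝟙 g) T
    rw [hcomp_id_comp_id] at this
    rw [this]
    exact (conj_cancel (Hom.comp_assoc f g _) (Hom.comp_assoc f g _) _).symm
  id_whiskerRight f g := hcomp_id_comp_id f g
  comp_whiskerRight T U g := by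
    have := hcomp_comp T U (𝟙 g) (𝟙 g)
    rwa [Category.comp_id] at this
  whiskerRight_id T := hcomp_id_right T
  whiskerRight_comp T g h := by
    have := hcomp_assoc T (𝟙 g) (𝟙 h)
    rwa [hcomp_id_comp_id] at this
  whisker_assoc f _ _ T h := by
    rw [hcomp_assoc (𝟙 f) T (𝟙 h)]
    exact (conj_cancel (Hom.comp_assoc f _ h) (Hom.comp_assoc f _ h) _).symm
  whisker_exchange {_ _ _ f g h i} T U := by
    have h1 := hcomp_comp (𝟙 f) T U (𝟙 i)
    have h2 := hcomp_comp T (𝟙 g) (𝟙 h) U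
    rw [Category.id_comp, Category.comp_id] at h1 h2
    exact h1.symm.trans h2
  pentagon f g h i := by
    simp only [eqToIso.hom, hcomp_eqToHom_left, hcomp_eqToHom_right, eqToHom_trans]
  triangle f g := by
    simp only [eqToIso.hom, hcomp_eqToHom_left, hcomp_eqToHom_right, eqToHom_trans]

/-- `2Mat_ℂ` is a strict 2-category. -/
instance : Bicategory.Strict TwoMat where
  id_comp := Hom.id_comp
  comp_id := Hom.comp_id
  assoc := Hom.comp_assoc
  leftUnitor_eqToIso _ := rfl
  rightUnitor_eqToIso _ := rfl
  associator_eqToIso _ _ _ := rfl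

end TwoMat

section TwoGroups

open MonoidalCategory

variable (G : Type u) [Category.{v} G] [MonoidalCategory G]

/-- A 2-group: a monoidal category in which every morphism is invertible and every object is
invertible, i.e. both translation functors `A ⊗ -` and `- ⊗ A` are equivalences. -/
class IsTwoGroup : Prop extends IsGroupoid G where
  tensorLeft_isEquivalence (A : G) : (tensorLeft A).IsEquivalence
  tensorRight_isEquivalence (A : G) : (tensorRight A).IsEquivalence

attribute [instance] IsTwoGroup.tensorLeft_isEquivalence IsTwoGroup.tensorRight_isEquivalence

/-- A monoidal category `G` regarded as a bicategory with a single object: 1- and 2-morphisms are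
the objects and morphisms of `G`, and the composite `B ∘ A` (first `A`, then `B`) is `B ⊗ A`. -/
structure Deloop (G : Type u) : Type where

namespace Deloop

instance bicategory : Bicategory (Deloop G) where
  Hom _ _ := G
  id _ := 𝟙_ G
  comp A B := B ⊗ A
  homCategory _ _ := inferInstanceAs (Category G)
  whiskerLeft A _ _ φ := φ ▷ A
  whiskerRight φ B := B ◁ φ
  associator A B C := (α_ C B A).symm
  leftUnitor A := ρ_ A
  rightUnitor A := λ_ A
  whisker_exchange φ ψ := (MonoidalCategory.whisker_exchange ψ φ).symm
  whiskerRight_comp := by intros; simp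
  comp_whiskerLeft := by intros; simp

variable {G}

/-- The unique object. -/
def star : Deloop G := ⟨⟩

/-- An object of `G` as a 1-morphism. -/
def hom (A : G) : (star : Deloop G) ⟶ star := A

/-- A morphism of `G` as a 2-morphism. -/
def hom₂ {A B : G} (φ : A ⟶ B) : hom A ⟶ hom B := φ

end Deloop

/-- `π₀(G)`: the isomorphism classes of objects, with the product `[A][B] = [A ⊗ B]`. -/
def Pi0 (G : Type u) [Category.{v} G] : Type u := Quotient (isIsomorphicSetoid G)

variable {G}

/-- The isomorphism class of an object. -/
def Pi0.mk {H : Type u} [Category.{v} H] (A : H) : Pi0 H := Quotient.mk (isIsomorphicSetoid H) A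

lemma Pi0.mk_eq {H : Type u} [Category.{v} H] {A B : H} (e : A ≅ B) : Pi0.mk A = Pi0.mk B :=
  Quotient.sound (s := isIsomorphicSetoid H) ⟨e⟩

instance : One (Pi0 G) := ⟨Pi0.mk (𝟙_ G)⟩

instance : Mul (Pi0 G) :=
  ⟨Quotient.map₂ (fun A B => A ⊗ B) fun _ _ ⟨e⟩ _ _ ⟨e'⟩ => ⟨e ⊗ᵢ e'⟩⟩

lemma Pi0.exists_mul_eq_one [IsTwoGroup G] (g : Pi0 G) : ∃ h : Pi0 G, h * g = 1 := by
  induction g using Quotient.inductionOn with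
  | _ A => exact ⟨Pi0.mk ((tensorRight A).objPreimage (𝟙_ G)),
      Pi0.mk_eq ((tensorRight A).objObjPreimageIso (𝟙_ G))⟩

instance [IsTwoGroup G] : Inv (Pi0 G) := ⟨fun g => (Pi0.exists_mul_eq_one g).choose⟩

instance [IsTwoGroup G] : Group (Pi0 G) :=
  Group.ofLeftAxioms
    (by
      intro a b c
      induction a, b, c using Quotient.inductionOn₃ with
      | _ A B C => exact Pi0.mk_eq (α_ A B C))
    (by
      intro a
      induction a using Quotient.inductionOn with
      | _ A => exact Pi0.mk_eq (λ_ A))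
    (fun a => (Pi0.exists_mul_eq_one a).choose_spec)

variable (G)

/-- `π₁(G)`: the (abelian) group of automorphisms of the unit object. -/
abbrev Pi1 : Type v := Aut (𝟙_ G)

variable {G}

/-- The homomorphism `γ_A(u) = l_A ∘ (u ⊗ id_A) ∘ l_A⁻¹` from `π₁(G)` to `Aut(A)`. -/
def gammaHom (A : G) : Pi1 G →* Aut A where
  toFun u := (λ_ A).symm ≪≫ whiskerRightIso u A ≪≫ λ_ A
  map_one' := by
    ext
    change (λ_ A).inv ≫ (𝟙 (𝟙_ G)) ▷ A ≫ (λ_ A).hom = 𝟙 A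
    simp
  map_mul' u w := by
    ext
    change (λ_ A).inv ≫ (w.hom ≫ u.hom) ▷ A ≫ (λ_ A).hom =
      ((λ_ A).inv ≫ w.hom ▷ A ≫ (λ_ A).hom) ≫ (λ_ A).inv ≫ u.hom ▷ A ≫ (λ_ A).hom
    simp

/-- The homomorphism `δ_A(u) = r_A ∘ (id_A ⊗ u) ∘ r_A⁻¹` from `π₁(G)` to `Aut(A)`. -/
def deltaHom (A : G) : Pi1 G →* Aut A where
  toFun u := (ρ_ A).symm ≪≫ whiskerLeftIso A u ≪≫ ρ_ A
  map_one' := by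
    ext
    change (ρ_ A).inv ≫ A ◁ (𝟙 (𝟙_ G)) ≫ (ρ_ A).hom = 𝟙 A
    simp
  map_mul' u w := by
    ext
    change (ρ_ A).inv ≫ A ◁ (w.hom ≫ u.hom) ≫ (ρ_ A).hom =
      ((ρ_ A).inv ≫ A ◁ w.hom ≫ (ρ_ A).hom) ≫ (ρ_ A).inv ≫ A ◁ u.hom ≫ (ρ_ A).hom
    simp

lemma gammaHom_hom (A : G) (u : Pi1 G) :
    (gammaHom A u).hom = (λ_ A).inv ≫ u.hom ▷ A ≫ (λ_ A).hom := rfl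

lemma deltaHom_hom (A : G) (u : Pi1 G) :
    (deltaHom A u).hom = (ρ_ A).inv ≫ A ◁ u.hom ≫ (ρ_ A).hom := rfl

lemma gammaHom_bijective [IsTwoGroup G] (A : G) : Function.Bijective (gammaHom A) := by
  constructor
  · intro u w h
    have h' := congrArg Iso.hom h
    rw [gammaHom_hom, gammaHom_hom] at h'
    have h2 := (cancel_epi _).1 h'
    have h3 := (cancel_mono _).1 h2
    exact Iso.ext ((tensorRight A).map_injective h3)
  · intro φ
    obtain ⟨f, hf⟩ := (tensorRight A).map_surjective ((λ_ A).hom ≫ φ.hom ≫ (λ_ A).inv)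
    refine ⟨(asIso f : Aut (𝟙_ G)), ?_⟩
    ext
    change (λ_ A).inv ≫ (tensorRight A).map f ≫ (λ_ A).hom = φ.hom
    rw [hf]; simp

/-- `γ_A` as an isomorphism `π₁(G) ≅ Aut(A)`. -/
def gamma [IsTwoGroup G] (A : G) : Pi1 G ≃* Aut A :=
  MulEquiv.ofBijective (gammaHom A) (gammaHom_bijective A)

lemma gammaHom_unit (u : Pi1 G) : gammaHom (𝟙_ G) u = u := by
  apply Iso.ext
  simp [gammaHom_hom, ← unitors_equal, ← unitors_inv_equal]

lemma deltaHom_unit (u : Pi1 G) : deltaHom (𝟙_ G) u = u := by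
  apply Iso.ext
  simp [deltaHom_hom, unitors_equal, unitors_inv_equal]

/-- The group `π₁` is abelian. -/
instance : CommGroup (Pi1 G) where
  mul_comm u w := by
    apply Iso.ext
    rw [← deltaHom_unit u, ← gammaHom_unit w]
    change (gammaHom _ w).hom ≫ (deltaHom _ u).hom = (deltaHom _ u).hom ≫ (gammaHom _ w).hom
    rw [gammaHom_hom, deltaHom_hom, unitors_equal, unitors_inv_equal]
    simp only [Category.assoc, Iso.hom_inv_id_assoc]
    rw [← MonoidalCategory.whisker_exchange_assoc]

lemma gammaHom_conj {A B : G} (e : A ≅ B) (u : Pi1 G) :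
    e.hom ≫ (gammaHom B u).hom = (gammaHom A u).hom ≫ e.hom := by
  rw [gammaHom_hom, gammaHom_hom]
  rw [← Category.assoc, leftUnitor_inv_naturality]
  simp only [Category.assoc, ← leftUnitor_naturality]
  rw [MonoidalCategory.whisker_exchange_assoc]

lemma deltaHom_conj {A B : G} (e : A ≅ B) (u : Pi1 G) :
    e.hom ≫ (deltaHom B u).hom = (deltaHom A u).hom ≫ e.hom := by
  rw [deltaHom_hom, deltaHom_hom]
  rw [← Category.assoc, rightUnitor_inv_naturality]
  simp only [Category.assoc, ← rightUnitor_naturality]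
  rw [MonoidalCategory.whisker_exchange_assoc]

lemma gamma_symm_delta_congr [IsTwoGroup G] {A B : G} (e : A ≅ B) (u : Pi1 G) :
    (gamma A).symm (deltaHom A u) = (gamma B).symm (deltaHom B u) := by
  rw [MulEquiv.symm_apply_eq]
  generalize hw : (gamma B).symm (deltaHom B u) = w
  rw [MulEquiv.symm_apply_eq] at hw
  apply Iso.ext
  have h1 : (deltaHom B u).hom = (gammaHom B w).hom := congrArg Iso.hom hw
  have h2 := deltaHom_conj e u
  rw [h1, gammaHom_conj] at h2
  exact ((cancel_mono _).1 h2).symm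

/-- The action of `π₀(G)` on `π₁(G)`: `[A] · u = γ_A⁻¹(δ_A(u))`. -/
def pi0Act [IsTwoGroup G] (g : Pi0 G) (u : Pi1 G) : Pi1 G :=
  Quotient.lift (s := isIsomorphicSetoid G) (fun A => (gamma A).symm (deltaHom A u))
    (fun _ _ ⟨e⟩ => gamma_symm_delta_congr e u) g

lemma gamma_pi0Act [IsTwoGroup G] (A : G) (u : Pi1 G) :
    gammaHom A (pi0Act (Pi0.mk A) u) = deltaHom A u :=
  (gamma A).apply_symm_apply _

/-- `π₁(G)` as a `π₀(G)`-module. -/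
instance [IsTwoGroup G] : MulDistribMulAction (Pi0 G) (Pi1 G) where
  smul := pi0Act
  one_smul u := by
    change pi0Act (Pi0.mk (𝟙_ G)) u = u
    rw [← gammaHom_unit (pi0Act _ u), gamma_pi0Act, deltaHom_unit]
  mul_smul g h u := by
    induction g, h using Quotient.inductionOn₂ with
    | _ A B =>
    change pi0Act (Pi0.mk (A ⊗ B)) u = pi0Act (Pi0.mk A) (pi0Act (Pi0.mk B) u)
    apply (gammaHom_bijective (A ⊗ B)).1
    rw [gamma_pi0Act]
    have h1 := congrArg Iso.hom (gamma_pi0Act B u)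
    generalize pi0Act (Pi0.mk B) u = w at *
    have h2 := congrArg Iso.hom (gamma_pi0Act A w)
    generalize pi0Act (Pi0.mk A) w = z at *
    apply Iso.ext
    have e1 : (deltaHom (A ⊗ B) u).hom = A ◁ (deltaHom B u).hom := by
      rw [deltaHom_hom, deltaHom_hom]; simp
    have e2 : (gammaHom (A ⊗ B) z).hom = (gammaHom A z).hom ▷ B := by
      rw [gammaHom_hom, gammaHom_hom]; simp
    have e3 : A ◁ (gammaHom B w).hom = (deltaHom A w).hom ▷ B := by
      rw [gammaHom_hom, deltaHom_hom]; simp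
    rw [e1, e2, ← h1, e3, h2]
  smul_one g := by
    induction g using Quotient.inductionOn with
    | _ A =>
    apply (gammaHom_bijective A).1
    exact (gamma_pi0Act A 1).trans (by rw [map_one, map_one])
  smul_mul g u w := by
    induction g using Quotient.inductionOn with
    | _ A =>
    apply (gammaHom_bijective A).1
    rw [map_mul]
    exact (gamma_pi0Act A (u * w)).trans (by
      rw [map_mul]
      exact (congrArg₂ (· * ·) (gamma_pi0Act A u) (gamma_pi0Act A w)).symm)

end TwoGroups

section Cochains

/-- The coboundary `(∂x)(g, h) = g · x(h) - x(gh) + x(g)` of a 1-cochain with values in a module `M`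
over a group `Γ`, in multiplicative notation; `act` is the action of `Γ` on `M`. -/
def coboundary₁ {Γ M : Type*} [Group Γ] [CommGroup M] (act : Γ → M → M) (x : Γ → M) (g h : Γ) :
    M :=
  act g (x h) * (x (g * h))⁻¹ * x g

/-- The coboundary `(∂c)(g, h, k) = g · c(h, k) - c(gh, k) + c(g, hk) - c(g, h)` of a 2-cochain, in
multiplicative notation. -/
def coboundary₂ {Γ M : Type*} [Group Γ] [CommGroup M] (act : Γ → M → M) (c : Γ → Γ → M)
    (g h k : Γ) : M :=
  act g (c h k) * (c (g * h) k)⁻¹ * c g (h * k) * (c g h)⁻¹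

/-- Normalized 2-cochains. -/
structure IsNormalized₂ {Γ M : Type*} [Group Γ] [CommGroup M] (c : Γ → Γ → M) : Prop where
  one_left (g : Γ) : c 1 g = 1
  one_right (g : Γ) : c g 1 = 1

end Cochains

section Classification

open MonoidalCategory

variable (G : Type u) [Category.{v} G] [MonoidalCategory G] [IsTwoGroup G]

/-- A choice of a representative `A_g` of every `g ∈ π₀(G)`, with `A_e = I`, and of isomorphisms
`ι_{g,h} : A_g ⊗ A_h ≅ A_{gh}` such that `ι_{e,g}` and `ι_{g,e}` are the unit constraints `l` and
`r` of `A_g`. The isomorphism `iso hk` is indexed by a proof of `g * h = k` only in order to avoid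
transports along equations such as `e * g = g`. If `G` is skeletal with trivial unit constraints,
all choices can be taken to be identities. -/
structure SkeletonData where
  obj : Pi0 G → G
  mk_obj (g : Pi0 G) : Pi0.mk (obj g) = g
  obj_one : obj 1 = 𝟙_ G
  iso {g h k : Pi0 G} (hk : g * h = k) : obj g ⊗ obj h ≅ obj k
  iso_one_left (g : Pi0 G) :
    (iso (one_mul g)).hom = eqToHom obj_one ▷ obj g ≫ (λ_ (obj g)).hom
  iso_one_right (g : Pi0 G) :
    (iso (mul_one g)).hom = obj g ◁ eqToHom obj_one ≫ (ρ_ (obj g)).hom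

variable {G}

/-- The associator transported to the representatives:
`ι_{g,hk} ∘ (id ⊗ ι_{h,k}) ∘ a ∘ (ι_{g,h}⁻¹ ⊗ id) ∘ ι_{gh,k}⁻¹`, an automorphism of `A_{ghk}`. -/
def SkeletonData.assocAut (D : SkeletonData G) (g h k : Pi0 G) : Aut (D.obj (g * h * k)) :=
  (D.iso (g := g * h) (h := k) rfl).symm ≪≫
    whiskerRightIso (D.iso (g := g) (h := h) rfl).symm (D.obj k) ≪≫
    α_ (D.obj g) (D.obj h) (D.obj k) ≪≫
    whiskerLeftIso (D.obj g) (D.iso (g := h) (h := k) rfl) ≪≫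
    D.iso (mul_assoc g h k).symm

/-- The 3-cocycle `α(g, h, k) = γ⁻¹(ã_{g,h,k})` of `G` defined by the choices `D`, where
`ã_{g,h,k}` is `D.assocAut g h k` and `γ = γ_{A_{ghk}}`. -/
def SkeletonData.cocycle (D : SkeletonData G) (g h k : Pi0 G) : Pi1 G :=
  (gamma (D.obj (g * h * k))).symm (D.assocAut g h k)

/-- `α` is a classifying 3-cocycle of `G`: a representative, among normalized 3-cocycles, of the
cohomology class of the 3-cocycles defined by choices of representatives and isomorphisms. -/
def IsClassifyingCocycle (α : Pi0 G → Pi0 G → Pi0 G → Pi1 G) : Prop :=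
  ∃ (D : SkeletonData G) (b : Pi0 G → Pi0 G → Pi1 G), IsNormalized₂ b ∧
    ∀ g h k, α g h k = D.cocycle g h k * coboundary₂ (fun g u => g • u) b g h k

/-- The action of `S_n` on `(ℂ*)ⁿ`: `(σ · l)ᵢ = l_{σ⁻¹(i)}`. Through a homomorphism `ρ` to `S_n` this
gives the module `(ℂ*)ⁿ_ρ`. -/
def permAct {n : ℕ} (σ : Equiv.Perm (Fin n)) (l : Fin n → ℂˣ) : Fin n → ℂˣ :=
  fun i => l (σ⁻¹ i)

/-- The data `(ρ, β, c)` of a quadruple `(n, ρ, β, c)`: a homomorphism `ρ : π₀(G) → S_n`, a morphism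
`β : π₁(G) → (ℂ*)ⁿ_ρ` of `π₀(G)`-modules, and a normalized 2-cochain `c` with values in `(ℂ*)ⁿ_ρ` such
that `∂c = β ∘ α`. The last equation says in particular that `[β ∘ α] = 0` in
`H³(π₀(G), (ℂ*)ⁿ_ρ)`. -/
structure RepData (α : Pi0 G → Pi0 G → Pi0 G → Pi1 G) (n : ℕ) where
  ρ : Pi0 G →* Equiv.Perm (Fin n)
  β : Pi1 G →* (Fin n → ℂˣ)
  β_smul (g : Pi0 G) (u : Pi1 G) : β (g • u) = permAct (ρ g) (β u)
  c : Pi0 G → Pi0 G → Fin n → ℂˣ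
  c_normalized : IsNormalized₂ c
  coboundary_c (g h k : Pi0 G) :
    coboundary₂ (fun g => permAct (ρ g)) c g h k = β (α g h k)

/-- The quadruples `(n, ρ, β, c)` with `n ≥ 1`. -/
structure Quadruple (α : Pi0 G → Pi0 G → Pi0 G → Pi1 G) where
  n : ℕ
  pos : 0 < n
  data : RepData α n

variable {α : Pi0 G → Pi0 G → Pi0 G → Pi1 G}

/-- Equivalence of quadruples of the same dimension `n`: there is `σ ∈ S_n` with `ρ' = σ ρ σ⁻¹`,
`β' = σ · β`, and `c' = (σ · c) + ∂x` for a normalized 1-cochain `x` with values in `(ℂ*)ⁿ_{ρ'}`. -/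
def RepData.Equivalent {n : ℕ} (q q' : RepData α n) : Prop :=
  ∃ σ : Equiv.Perm (Fin n),
    (∀ g, q'.ρ g = σ * q.ρ g * σ⁻¹) ∧
    (∀ u, q'.β u = permAct σ (q.β u)) ∧
    ∃ x : Pi0 G → Fin n → ℂˣ, x 1 = 1 ∧
      ∀ g h, q'.c g h = permAct σ (q.c g h) * coboundary₁ (fun g => permAct (q'.ρ g)) x g h

/-- Quadruples are equivalent if they have the same `n` and are related by `RepData.Equivalent`. -/
inductive Quadruple.Equivalent : Quadruple α → Quadruple α → Prop
  | mk {n : ℕ} (pos : 0 < n) (q q' : RepData α n) (h : q.Equivalent q') :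
      Quadruple.Equivalent ⟨n, pos, q⟩ ⟨n, pos, q'⟩

lemma RepData.equivalent_refl {n : ℕ} (q : RepData α n) : q.Equivalent q := by
  refine ⟨1, fun g => by simp, fun u => rfl, 1, rfl, fun g h => ?_⟩
  funext i
  simp [permAct, coboundary₁]

lemma RepData.Equivalent.symm {n : ℕ} {q q' : RepData α n} (h : q.Equivalent q') :
    q'.Equivalent q := by
  obtain ⟨σ, h1, h2, x, hx, h3⟩ := h
  refine ⟨σ⁻¹, fun g => by rw [h1]; group, fun u => ?_,
    fun g => permAct σ⁻¹ (x g)⁻¹, ?_, fun g h => ?_⟩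
  · rw [h2]; funext i; simp [permAct]
  · funext i; simp [permAct, hx]
  · rw [h3]
    funext i
    have e : (q.ρ g)⁻¹ i = σ⁻¹ ((q'.ρ g)⁻¹ (σ i)) := by
      rw [h1]; simp [mul_inv_rev]
    have c1 : ∀ i, σ⁻¹ (σ i) = i := σ.symm_apply_apply
    have c2 : ∀ i, σ (σ⁻¹ i) = i := σ.apply_symm_apply
    simp only [permAct, coboundary₁, Pi.mul_apply, Pi.inv_apply, inv_inv, e, c1, c2]
    generalize x h _ = a
    generalize x (g * h) _ = b
    generalize x g _ = d
    generalize q.c g h i = z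
    rw [mul_assoc z, show a * b⁻¹ * d * (a⁻¹ * b * d⁻¹) = 1 by
      rw [show a⁻¹ * b * d⁻¹ = (a * b⁻¹ * d)⁻¹ by simp only [mul_inv, inv_inv], mul_inv_cancel],
      mul_one]

lemma RepData.Equivalent.trans {n : ℕ} {q q' q'' : RepData α n} (h : q.Equivalent q')
    (h' : q'.Equivalent q'') : q.Equivalent q'' := by
  obtain ⟨σ, h1, h2, x, hx, h3⟩ := h
  obtain ⟨τ, k1, k2, y, hy, k3⟩ := h'
  refine ⟨τ * σ, fun g => by rw [k1, h1]; group, fun u => ?_,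
    fun g => permAct τ (x g) * y g, ?_, fun g h => ?_⟩
  · rw [k2, h2]; funext i; simp [permAct, mul_inv_rev]
  · funext i; simp [permAct, hx, hy]
  · rw [k3, h3]
    funext i
    have e : (q'.ρ g)⁻¹ (τ⁻¹ i) = τ⁻¹ ((q''.ρ g)⁻¹ i) := by
      rw [k1]; simp [mul_inv_rev]
    simp only [permAct, coboundary₁, Pi.mul_apply, Pi.inv_apply, mul_inv_rev, e,
      Equiv.Perm.mul_apply]
    simp only [mul_comm, mul_left_comm, mul_assoc]

variable (α) in
/-- Equivalence of quadruples, as an equivalence relation. -/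
def Quadruple.setoid : Setoid (Quadruple α) where
  r := Quadruple.Equivalent
  iseqv :=
    { refl := fun Q => .mk Q.pos _ _ Q.data.equivalent_refl
      symm := by rintro _ _ ⟨pos, q, q', h⟩; exact .mk pos _ _ h.symm
      trans := by
        rintro _ _ _ ⟨pos, q, q', h⟩ ⟨_, _, q'', h'⟩
        exact .mk pos _ _ (h.trans h') }

end Classification

section Representations

open Bicategory

/-- Two objects of a bicategory are equivalent if there is a 1-morphism between them that is
invertible up to 2-isomorphism. -/
def AreEquivalent {B : Type*} [Bicategory B] (X Y : B) : Prop :=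
  ∃ (f : X ⟶ Y) (g : Y ⟶ X), Nonempty (f ≫ g ≅ 𝟙 X) ∧ Nonempty (g ≫ f ≅ 𝟙 Y)

lemma areEquivalent_equivalence (B : Type*) [Bicategory B] :
    Equivalence (AreEquivalent (B := B)) where
  refl X := ⟨𝟙 X, 𝟙 X, ⟨λ_ _⟩, ⟨λ_ _⟩⟩
  symm := fun ⟨f, g, h, k⟩ => ⟨g, f, k, h⟩
  trans := fun ⟨f, g, ⟨h⟩, ⟨k⟩⟩ ⟨f', g', ⟨h'⟩, ⟨k'⟩⟩ =>
    ⟨f ≫ f', g' ≫ g,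
      ⟨α_ f f' (g' ≫ g) ≪≫ whiskerLeftIso f ((α_ f' g' g).symm ≪≫ whiskerRightIso h' g ≪≫ λ_ g) ≪≫
        h⟩,
      ⟨α_ g' g (f ≫ f') ≪≫ whiskerLeftIso g' ((α_ g f f').symm ≪≫ whiskerRightIso k f' ≪≫ λ_ f') ≪≫
        k'⟩⟩

variable (G : Type u) [Category.{v} G] [MonoidalCategory G]

/-- Representations of `G` on `2Mat_ℂ`: pseudofunctors from the one-object bicategory of `G` to
`2Mat_ℂ`. They are the objects of the pseudofunctor bicategory, whose 1- and 2-morphisms are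
pseudonatural transformations and modifications. -/
abbrev TwoMatRep : Type _ := Pseudofunctor (Deloop G) TwoMat

variable {G}

/-- The dimension of a representation. -/
def TwoMatRep.dim (F : TwoMatRep G) : ℕ := (F.obj Deloop.star).dim

variable (G)

/-- Nonzero representations: those of dimension at least 1. -/
def NonzeroRep : Type _ := {F : TwoMatRep G // 0 < F.dim}

open scoped Pseudofunctor.StrongTrans in
/-- Equivalence of nonzero representations in the bicategory of representations. -/
def NonzeroRep.setoid : Setoid (NonzeroRep G) where
  r F F' := AreEquivalent F.1 F'.1
  iseqv := (areEquivalent_equivalence (TwoMatRep G)).comap Subtype.val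

/-- The 1-morphism `(P(σ), I)`: the permutation matrix `P(σ)ᵢⱼ = δ_{i,σ(j)}` with the trivial gauge. -/
def TwoMat.permHom {n : TwoMat} (σ : Equiv.Perm (Fin n.dim)) : n ⟶ n where
  rank i j := if i = σ j then 1 else 0
  gauge _ _ := 1
  gauge_single _ _ := rfl

/-- The `(i, j)` entry of a 2-morphism of `2Mat_ℂ`. -/
def TwoMat.entry {n m : TwoMat} {f g : n ⟶ m} (T : f ⟶ g) (i : Fin m.dim) (j : Fin n.dim) :
    Matrix (Fin (TwoMat.Hom.rank g i j)) (Fin (TwoMat.Hom.rank f i j)) ℂ := T i j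

variable {G} [IsTwoGroup G] {α : Pi0 G → Pi0 G → Pi0 G → Pi1 G}

open MonoidalCategory in
/-- The structural isomorphism of `F` on the skeleton of `G` chosen by `D`:
`F(ι_{g,h}) ∘ F₂(A_g, A_h) : F(A_g) ∘ F(A_h) ⇒ F(A_{gh})`. -/
def SkeletonData.structIso (D : SkeletonData G) (F : TwoMatRep G) (g h : Pi0 G) :
    F.map (Deloop.hom (D.obj h)) ≫ F.map (Deloop.hom (D.obj g)) ⟶
      F.map (Deloop.hom (D.obj (g * h))) :=
  (F.mapComp (Deloop.hom (D.obj h)) (Deloop.hom (D.obj g))).inv ≫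
    F.map₂ (Deloop.hom₂ (D.iso (g := g) (h := h) rfl).hom)

/-- `F` is a gauge trivial representation with data `(ρ, β, c)` on the skeleton chosen by `D`:
`F(A_g) = (P(ρ(g)), I)`; for an automorphism `φ` of `A_g`, the nonempty entries of `F(φ)` are
`F(φ)_{ρ(g)(j), j} = β(γ⁻¹(φ))_{ρ(g)(j)}`; and the nonempty entries of the structural isomorphism
`F(A_g) ∘ F(A_h) ⇒ F(A_{gh})` are `c(g, h)_{ρ(gh)(j)}` at `(ρ(gh)(j), j)`. All these entries are
`1 × 1` matrices. -/
structure SkeletonData.RealizesData (D : SkeletonData G) (F : TwoMatRep G)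
    (q : RepData α F.dim) : Prop where
  map_obj (g : Pi0 G) : F.map (Deloop.hom (D.obj g)) = TwoMat.permHom (q.ρ g)
  map_aut (g : Pi0 G) (φ : Aut (D.obj g)) (j : Fin F.dim) :
    TwoMat.entry (F.map₂ (Deloop.hom₂ φ.hom)) (q.ρ g j) j =
      Matrix.of fun _ _ => (q.β ((gamma (D.obj g)).symm φ) (q.ρ g j) : ℂ)
  map_tensor (g h : Pi0 G) (j : Fin F.dim) :
    TwoMat.entry (D.structIso F g h) (q.ρ (g * h) j) j =
      Matrix.of fun _ _ => (q.c g h (q.ρ (g * h) j) : ℂ)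

/-- `F` is a gauge trivial representation determined by the quadruple `Q` (and the choices `D`). -/
def SkeletonData.Realizes (D : SkeletonData G) (Q : Quadruple α) (F : NonzeroRep G) : Prop :=
  ∃ q : RepData α F.1.dim, Q = ⟨F.1.dim, F.2, q⟩ ∧ D.RealizesData F.1 q

end Representations

end

/-!
The proof replaces pseudofunctors to `2Mat_ℂ` by their scalars, which live in the abelian groups
`(ℂ*)ⁿ`, so that every coherence condition becomes an identity of cochains.

*Scalars of 2-morphisms.* An object `A` of a 2-group is invertible, hence so is the 1-morphism `F(A)`
of `2Mat_ℂ`, and its rank matrix is invertible over `ℕ`. Such a matrix is a permutation matrix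
(`TwoMat.exists_isPerm`). A 2-isomorphism between 1-morphisms with the same permutation matrix is a
family of `1 × 1` matrices, that is, an element of `(ℂ*)ⁿ` (`TwoMat.coefUnit`), whatever the gauges
are: gauges only enter horizontal composition, and there only through their values at basis vectors,
which are trivial (`TwoMat.sum_applyMat`). Vertical composition multiplies scalars, whiskering on
the side of the source does not change them and whiskering on the side of the target permutes them.
Associators and unitors of `2Mat_ℂ` are identities and have scalars 1.

*Scalars of representations.* A representation thus amounts to a `ScalarRep`: a homomorphism
`π₀(G) → S_n` and scalars of `F(φ)`, `F(A ⊗ B) ⇒ F(A) ∘ F(B)` and `F(I) ⇒ id` (`TwoMatRep.scalarRep`,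
`ScalarRep.toRep`). Two representations are equivalent if and only if their scalars agree up to a
bijection of the coordinates and the scalars of the naturality 2-isomorphisms
(`TwoMatRep.areEquivalent_iff`).

*From representations to quadruples.* Fix a choice `D` with `α_D = α`. The scalars `β` of `π₁(G)` and
the cochain of scalars of `F(A_g) ∘ F(A_h) ⇒ F(A_{gh})` satisfy `∂c = β ∘ α` (`coboundary_cochain`),
because the associator of `G` on the representatives is `α`. Subtracting the coboundary of a
constant 1-cochain normalizes `c`, and this gives the data `ScalarRep.repData`. Since any object is
isomorphic to a representative `A_g`, scalars are equivalent if and only if their data are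
(`ScalarRep.nonempty_equivalence_iff`). Hence classes of nonzero representations inject into
classes of quadruples.

*From quadruples to representations.* After choosing isomorphisms `A ≅ A_g`, every morphism of `G`
has a coordinate in `π₁(G)`, and so has every tensor product (`SkeletonData.homClass`,
`SkeletonData.tensorDiff`). Applying `β` to these coordinates and correcting by `c` gives scalars
with the prescribed data (`RepData.scalarRep`); the condition `∂c = β ∘ α` is the compatibility with
the associator. A representation realizing a quadruple has exactly that quadruple as its data
(`SkeletonData.Realizes.eq_quadruple`), so that the injection above is also surjective and its
inverse is the required bijection.
-/

noncomputable section

/-! ### Coordinate permutations and the scalars of 2-morphisms of `2Mat_ℂ` -/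

section PermutationModules

/-- The isomorphism `(ℂ*)ⁿ → (ℂ*)ᵐ` of permutation of coordinates by a bijection `σ`;
for `n = m` it is `permAct σ`. -/
def coordPerm {n m : ℕ} (σ : Fin n ≃ Fin m) : (Fin n → ℂˣ) →* (Fin m → ℂˣ) where
  toFun l i := l (σ.symm i)
  map_one' := rfl
  map_mul' _ _ := rfl

lemma coordPerm_apply {n m : ℕ} (σ : Fin n ≃ Fin m) (l : Fin n → ℂˣ) (i : Fin m) :
    coordPerm σ l i = l (σ.symm i) := rfl

lemma permAct_eq_coordPerm {n : ℕ} (σ : Equiv.Perm (Fin n)) (l : Fin n → ℂˣ) :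
    permAct σ l = coordPerm σ l := rfl

lemma coordPerm_trans {n m p : ℕ} (σ : Fin n ≃ Fin m) (τ : Fin m ≃ Fin p) (l : Fin n → ℂˣ) :
    coordPerm (σ.trans τ) l = coordPerm τ (coordPerm σ l) := rfl

lemma coordPerm_mul {n : ℕ} (σ τ : Equiv.Perm (Fin n)) (l : Fin n → ℂˣ) :
    coordPerm (σ * τ) l = coordPerm σ (coordPerm τ l) := rfl

lemma coordPerm_one {n : ℕ} (l : Fin n → ℂˣ) :
    coordPerm (1 : Equiv.Perm (Fin n)) l = l := rfl

lemma coordPerm_symm_apply {n m : ℕ} (σ : Fin n ≃ Fin m) (l : Fin m → ℂˣ) :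
    coordPerm σ (coordPerm σ.symm l) = l := by
  funext i; simp [coordPerm_apply]

lemma coordPerm_apply_symm {n m : ℕ} (σ : Fin n ≃ Fin m) (l : Fin n → ℂˣ) :
    coordPerm σ.symm (coordPerm σ l) = l := by
  funext i; simp [coordPerm_apply]

end PermutationModules

namespace TwoMat

open Matrix Bicategory

variable {n m p : TwoMat}

/-- The rank matrix of `f` is the permutation matrix of the bijection `σ`; there is no condition on
the gauge. -/
def IsPerm (f : n ⟶ m) (σ : Fin n.dim ≃ Fin m.dim) : Prop :=
  ∀ i j, Hom.rank f i j = if i = σ j then 1 else 0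

lemma IsPerm.id (n : TwoMat) : IsPerm (𝟙 n) (Equiv.refl _) := fun _ _ => rfl

lemma IsPerm.rank_self {f : n ⟶ m} {σ : Fin n.dim ≃ Fin m.dim} (hf : IsPerm f σ) (j : Fin n.dim) :
    Hom.rank f (σ j) j = 1 := by rw [hf, if_pos rfl]

lemma IsPerm.column {f : n ⟶ m} {σ : Fin n.dim ≃ Fin m.dim} (hf : IsPerm f σ) (j : Fin n.dim) :
    (fun i => Hom.rank f i j) = Pi.single (σ j) 1 := by
  funext i
  rw [hf, Pi.single_apply]

lemma IsPerm.comp {f : n ⟶ m} {g : m ⟶ p} {σ : Fin n.dim ≃ Fin m.dim} {τ : Fin m.dim ≃ Fin p.dim}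
    (hf : IsPerm f σ) (hg : IsPerm g τ) : IsPerm (f ≫ g) (σ.trans τ) := by
  intro k j
  change Hom.rank g k ⬝ᵥ (fun i => Hom.rank f i j) = _
  rw [hf.column, dotProduct_single', hg]
  rfl

lemma IsPerm.unique {f : n ⟶ m} {σ τ : Fin n.dim ≃ Fin m.dim} (h : IsPerm f σ) (h' : IsPerm f τ) :
    σ = τ := by
  ext j : 1
  by_contra hne
  have := h.rank_self j
  rw [h', if_neg hne] at this
  exact zero_ne_one this

/-- The 1-morphism with the permutation matrix of `σ` as rank matrix and with trivial gauge. -/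
def ofEquiv (σ : Fin n.dim ≃ Fin m.dim) : n ⟶ m where
  rank i j := if i = σ j then 1 else 0
  gauge _ _ := 1
  gauge_single _ _ := rfl

lemma isPerm_ofEquiv (σ : Fin n.dim ≃ Fin m.dim) : IsPerm (ofEquiv σ) σ := fun _ _ => rfl

lemma rank_eq_of_iso {f g : n ⟶ m} (e : f ≅ g) (i : Fin m.dim) (j : Fin n.dim) :
    Hom.rank f i j = Hom.rank g i j := by
  have h1 : entry e.inv i j * entry e.hom i j = 1 := congrFun (congrFun e.hom_inv_id i) j
  have h2 : entry e.hom i j * entry e.inv i j = 1 := congrFun (congrFun e.inv_hom_id i) j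
  simpa using Matrix.square_of_invertible _ _ h1 h2

lemma IsPerm.congr {f g : n ⟶ m} {σ : Fin n.dim ≃ Fin m.dim} (h : IsPerm f σ) (e : f ≅ g) :
    IsPerm g σ := fun i j => (rank_eq_of_iso e i j).symm.trans (h i j)

/-- The rank matrix of a 1-morphism that is invertible up to 2-isomorphism is invertible over `ℕ`,
hence a permutation matrix. -/
lemma exists_isPerm {f : n ⟶ m} {g : m ⟶ n} (e : f ≫ g ≅ 𝟙 n) (e' : g ≫ f ≅ 𝟙 m) :
    ∃ σ : Fin n.dim ≃ Fin m.dim, IsPerm f σ := by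
  have h1 : ∀ j j', ∑ i, Hom.rank g j i * Hom.rank f i j' = if j = j' then 1 else 0 :=
    rank_eq_of_iso e
  have h2 : ∀ i i', ∑ j, Hom.rank f i j * Hom.rank g j i' = if i = i' then 1 else 0 :=
    rank_eq_of_iso e'
  have ex1 : ∀ j, ∃ i, Hom.rank g j i = 1 ∧ Hom.rank f i j = 1 := by
    intro j
    have h : ∑ i, Hom.rank g j i * Hom.rank f i j ≠ 0 := by rw [h1]; simp
    obtain ⟨i, -, hi⟩ := Finset.exists_ne_zero_of_sum_ne_zero h
    suffices h : Hom.rank g j i * Hom.rank f i j = 1 by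
      exact ⟨i, Nat.eq_one_of_mul_eq_one_right h, Nat.eq_one_of_mul_eq_one_left h⟩
    refine le_antisymm ?_ (Nat.one_le_iff_ne_zero.2 hi)
    refine (Finset.single_le_sum (f := fun i => Hom.rank g j i * Hom.rank f i j)
      (fun _ _ => Nat.zero_le _) (Finset.mem_univ i)).trans ?_
    rw [h1, if_pos rfl]
  have ex2 : ∀ i, ∃ j, Hom.rank f i j = 1 ∧ Hom.rank g j i = 1 := by
    intro i
    have h : ∑ j, Hom.rank f i j * Hom.rank g j i ≠ 0 := by rw [h2]; simp
    obtain ⟨j, -, hj⟩ := Finset.exists_ne_zero_of_sum_ne_zero h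
    suffices h : Hom.rank f i j * Hom.rank g j i = 1 by
      exact ⟨j, Nat.eq_one_of_mul_eq_one_right h, Nat.eq_one_of_mul_eq_one_left h⟩
    refine le_antisymm ?_ (Nat.one_le_iff_ne_zero.2 hj)
    refine (Finset.single_le_sum (f := fun j => Hom.rank f i j * Hom.rank g j i)
      (fun _ _ => Nat.zero_le _) (Finset.mem_univ j)).trans ?_
    rw [h2, if_pos rfl]
  choose s hs using ex1
  choose t ht using ex2
  -- In a product equal to an identity matrix, no off-diagonal entry has a nonzero summand.
  have row : ∀ j j', j ≠ j' → Hom.rank f (s j) j' = 0 := by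
    intro j j' hne
    have h := h1 j j'
    rw [if_neg hne, Finset.sum_eq_zero_iff] at h
    simpa [(hs j).1] using h (s j) (Finset.mem_univ _)
  have col : ∀ i i', i ≠ i' → Hom.rank f i (t i') = 0 := by
    intro i i' hne
    have h := h2 i i'
    rw [if_neg hne, Finset.sum_eq_zero_iff] at h
    simpa [(ht i').2] using h (t i') (Finset.mem_univ _)
  have ts : ∀ j, t (s j) = j := by
    intro j
    by_contra hne
    have := row j (t (s j)) (Ne.symm hne)
    rw [(ht (s j)).1] at this
    exact one_ne_zero this
  have st : ∀ i, s (t i) = i := by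
    intro i
    by_contra hne
    have := col (s (t i)) i hne
    rw [(hs (t i)).2] at this
    exact one_ne_zero this
  refine ⟨⟨s, t, ts, st⟩, fun i j => ?_⟩
  obtain ⟨j', rfl⟩ : ∃ j', i = s j' := ⟨t i, (st i).symm⟩
  by_cases h : j' = j
  · subst h; simp [(hs j').2]
  · rw [row _ _ h, if_neg]
    intro h'
    exact h ((ts j').symm.trans ((congrArg t h').trans (ts j)))

/-- The scalars of a 2-morphism: the `i`-th one is the sum of all entries of the matrices in row
`i`. If the source and the target have the permutation matrix of `σ` as rank matrix, this is the
only entry of the `1 × 1` matrix at the position `(i, σ⁻¹(i))`. -/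
def coef {f g : n ⟶ m} (T : f ⟶ g) (i : Fin m.dim) : ℂ := ∑ j, ∑ s, ∑ t, entry T i j s t

lemma coef_apply {f g : n ⟶ m} {σ : Fin n.dim ≃ Fin m.dim} (hf : IsPerm f σ) (hg : IsPerm g σ)
    (T : f ⟶ g) (j : Fin n.dim) (s : Fin (Hom.rank g (σ j) j)) (t : Fin (Hom.rank f (σ j) j)) :
    coef T (σ j) = entry T (σ j) j s t := by
  have hs : Subsingleton (Fin (Hom.rank g (σ j) j)) := by rw [hg.rank_self]; infer_instance
  have ht : Subsingleton (Fin (Hom.rank f (σ j) j)) := by rw [hf.rank_self]; infer_instance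
  rw [coef, Finset.sum_eq_single j]
  · rw [Fintype.sum_subsingleton _ s, Fintype.sum_subsingleton _ t]
  · intro j' _ hne
    have : IsEmpty (Fin (Hom.rank g (σ j) j')) := by
      rw [hg, if_neg (fun h => hne (σ.injective h).symm)]; infer_instance
    simp
  · simp

lemma hom₂_ext {f g : n ⟶ m} {σ : Fin n.dim ≃ Fin m.dim} (hf : IsPerm f σ) (hg : IsPerm g σ)
    {T T' : f ⟶ g} (h : coef T = coef T') : T = T' := by
  funext i j
  ext s t
  obtain ⟨j', rfl⟩ := σ.surjective i
  by_cases hj : j' = j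
  · subst hj
    exact (coef_apply hf hg T j' s t).symm.trans
      ((congrFun h _).trans (coef_apply hf hg T' j' s t))
  · have : IsEmpty (Fin (Hom.rank g (σ j') j)) := by
      rw [hg, if_neg (fun h => hj (σ.injective h))]; infer_instance
    exact this.elim s

lemma coef_id {f : n ⟶ m} {σ : Fin n.dim ≃ Fin m.dim} (hf : IsPerm f σ) : coef (𝟙 f) = 1 := by
  funext i
  obtain ⟨j, rfl⟩ := σ.surjective i
  have s : Fin (Hom.rank f (σ j) j) := ⟨0, by rw [hf.rank_self]; exact one_pos⟩
  rw [coef_apply hf hf _ j s s]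
  exact Matrix.one_apply_eq s

lemma coef_comp {f g h : n ⟶ m} {σ : Fin n.dim ≃ Fin m.dim} (hf : IsPerm f σ) (hg : IsPerm g σ)
    (hh : IsPerm h σ) (T : f ⟶ g) (U : g ⟶ h) : coef (T ≫ U) = coef T * coef U := by
  funext i
  obtain ⟨j, rfl⟩ := σ.surjective i
  have s : Fin (Hom.rank f (σ j) j) := ⟨0, by rw [hf.rank_self]; exact one_pos⟩
  have t : Fin (Hom.rank g (σ j) j) := ⟨0, by rw [hg.rank_self]; exact one_pos⟩
  have w : Fin (Hom.rank h (σ j) j) := ⟨0, by rw [hh.rank_self]; exact one_pos⟩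
  have ht : Subsingleton (Fin (Hom.rank g (σ j) j)) := by rw [hg.rank_self]; infer_instance
  rw [Pi.mul_apply, coef_apply hf hh _ j w s, coef_apply hf hg _ j t s, coef_apply hg hh _ j w t]
  change (entry U (σ j) j * entry T (σ j) j) w s = _
  rw [Matrix.mul_apply, Fintype.sum_subsingleton _ t, mul_comm]

/-- The sum of the entries of `⨁ⱼ (Tⱼ ⊗ Mⱼ)`. -/
lemma sum_tensorSum {k : ℕ} {r r' a b : Fin k → ℕ} (T : ∀ j, Matrix (Fin (r' j)) (Fin (r j)) ℂ)
    (M : ∀ j, Matrix (Fin (b j)) (Fin (a j)) ℂ) :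
    ∑ x, ∑ y, tensorSum T M x y = ∑ j, (∑ s, ∑ t, T j s t) * ∑ s, ∑ t, M j s t := by
  rw [← Equiv.sum_comp (lex r' b), Fintype.sum_sigma]
  refine Finset.sum_congr rfl fun j _ => ?_
  have inner : ∀ s p, ∑ y, tensorSum T M (lex r' b ⟨j, s, p⟩) y =
      (∑ t, T j s t) * ∑ q, M j p q := by
    intro s p
    rw [← Equiv.sum_comp (lex r a), Fintype.sum_sigma, Finset.sum_eq_single j]
    · rw [Fintype.sum_prod_type, Finset.sum_mul_sum]
      refine Finset.sum_congr rfl fun t _ => Finset.sum_congr rfl fun q _ => ?_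
      exact (tensorSum_lex T M j j s p t q).trans (dif_pos rfl)
    · intro j' _ hne
      exact Finset.sum_eq_zero fun y _ =>
        (tensorSum_lex T M j j' s p y.1 y.2).trans (dif_neg hne)
    · simp
  rw [Fintype.sum_prod_type, Finset.sum_mul_sum]
  exact Finset.sum_congr rfl fun s _ => Finset.sum_congr rfl fun p _ => inner s p

/-- The gauges at basis vectors are trivial, so that they do not contribute to horizontal
composites of 2-morphisms between 1-morphisms with permutation matrices as rank matrices. -/
lemma sum_applyMat {f g : Hom n m} (U : Hom₂ f g) {a b : Fin n.dim → ℕ} (j : Fin n.dim)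
    (ha : a = Pi.single j 1) (hb : b = Pi.single j 1)
    (M : ∀ j, Matrix (Fin (b j)) (Fin (a j)) ℂ) (i : Fin m.dim) :
    ∑ x, ∑ y, applyMat U M i x y = (∑ s, ∑ t, U i j s t) * ∑ s, ∑ t, M j s t := by
  subst ha hb
  simp only [applyMat, Hom.gauge_single, inv_one, Units.val_one, Matrix.mul_one, Matrix.one_mul]
  rw [sum_tensorSum, Finset.sum_eq_single j]
  · intro j' _ hne
    have : IsEmpty (Fin ((Pi.single j 1 : Fin n.dim → ℕ) j')) := by
      rw [Pi.single_eq_of_ne hne]; infer_instance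
    simp
  · simp

/-- Precomposition with `f` permutes the columns, and so does not change the sums over rows. -/
lemma coef_whiskerLeft {f : n ⟶ m} {σ : Fin n.dim ≃ Fin m.dim} (hf : IsPerm f σ) {g g' : m ⟶ p}
    (U : g ⟶ g') : coef (f ◁ U) = coef U := by
  funext k
  rw [coef, coef, ← Equiv.sum_comp σ]
  refine Finset.sum_congr rfl fun j _ => ?_
  refine (sum_applyMat U (σ j) (hf.column j) (hf.column j) (fun i => 𝟙 f i j) k).trans ?_
  have s : Fin (Hom.rank f (σ j) j) := ⟨0, by rw [hf.rank_self]; exact one_pos⟩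
  have hs : Subsingleton (Fin (Hom.rank f (σ j) j)) := by rw [hf.rank_self]; infer_instance
  rw [Fintype.sum_subsingleton _ s, Fintype.sum_subsingleton _ s]
  rw [show (𝟙 f : f ⟶ f) (σ j) j s s = 1 from Matrix.one_apply_eq s, mul_one]
  rfl

lemma coef_whiskerRight {f f' : n ⟶ m} {σ : Fin n.dim ≃ Fin m.dim} (hf : IsPerm f σ)
    (hf' : IsPerm f' σ) {g : m ⟶ p} {τ : Fin m.dim ≃ Fin p.dim} (hg : IsPerm g τ)
    (T : f ⟶ f') (k : Fin p.dim) : coef (T ▷ g) k = coef T (τ.symm k) := by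
  obtain ⟨i, rfl⟩ := τ.surjective k
  obtain ⟨j, rfl⟩ := σ.surjective i
  have e : ∀ j', ∑ s, ∑ t, entry (T ▷ g) (τ (σ j)) j' s t =
      (∑ s, ∑ t, entry (𝟙 g) (τ (σ j)) (σ j') s t) * ∑ s, ∑ t, entry T (σ j') j' s t :=
    fun j' => sum_applyMat (𝟙 g) (σ j') (hf.column j') (hf'.column j') (fun i => T i j') (τ (σ j))
  have s : Fin (Hom.rank g (τ (σ j)) (σ j)) := ⟨0, by rw [hg.rank_self]; exact one_pos⟩
  have hs : Subsingleton (Fin (Hom.rank g (τ (σ j)) (σ j))) := by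
    rw [hg.rank_self]; infer_instance
  have t : Fin (Hom.rank f (σ j) j) := ⟨0, by rw [hf.rank_self]; exact one_pos⟩
  have t' : Fin (Hom.rank f' (σ j) j) := ⟨0, by rw [hf'.rank_self]; exact one_pos⟩
  have ht : Subsingleton (Fin (Hom.rank f (σ j) j)) := by rw [hf.rank_self]; infer_instance
  have ht' : Subsingleton (Fin (Hom.rank f' (σ j) j)) := by rw [hf'.rank_self]; infer_instance
  rw [Equiv.symm_apply_apply, coef, Finset.sum_congr rfl fun j' _ => e j', Finset.sum_eq_single j]
  · rw [Fintype.sum_subsingleton _ s, Fintype.sum_subsingleton _ s, Fintype.sum_subsingleton _ t',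
      Fintype.sum_subsingleton _ t, coef_apply hf hf' T j t' t]
    rw [show entry (𝟙 g) (τ (σ j)) (σ j) s s = 1 from Matrix.one_apply_eq s, one_mul]
  · intro j' _ hne
    have : IsEmpty (Fin (Hom.rank g (τ (σ j)) (σ j'))) := by
      rw [hg, if_neg (fun h => hne (σ.injective (τ.injective h)).symm)]; infer_instance
    simp
  · simp

/-- The invertible scalars of a 2-isomorphism. The value for vanishing scalars, which do not occur
for isomorphisms of 1-morphisms with permutation matrices as rank matrices, is 1. -/
def coefUnit {f g : n ⟶ m} (T : f ⟶ g) (i : Fin m.dim) : ℂˣ :=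
  if h : coef T i = 0 then 1 else Units.mk0 _ h

lemma val_coefUnit {f g : n ⟶ m} {σ : Fin n.dim ≃ Fin m.dim} (hf : IsPerm f σ) (T : f ⟶ g)
    [IsIso T] (i : Fin m.dim) : (coefUnit T i : ℂ) = coef T i := by
  have hg := hf.congr (asIso T)
  have h : coef T i * coef (inv T) i = 1 := by
    rw [← Pi.mul_apply, ← coef_comp hf hg hf, IsIso.hom_inv_id, coef_id hf, Pi.one_apply]
  rw [coefUnit, dif_neg (left_ne_zero_of_mul_eq_one h), Units.val_mk0]

/-- The rank matrix of `f` is a permutation matrix. -/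
class IsPermutational (f : n ⟶ m) : Prop where
  exists_isPerm : ∃ σ, IsPerm f σ

instance (n : TwoMat) : IsPermutational (𝟙 n) := ⟨_, IsPerm.id n⟩

instance (f : n ⟶ m) (g : m ⟶ p) [hf : IsPermutational f] [hg : IsPermutational g] :
    IsPermutational (f ≫ g) :=
  let ⟨_, h⟩ := hf.exists_isPerm
  let ⟨_, h'⟩ := hg.exists_isPerm
  ⟨_, h.comp h'⟩

instance (σ : Fin n.dim ≃ Fin m.dim) : IsPermutational (ofEquiv σ) := ⟨σ, isPerm_ofEquiv σ⟩

lemma IsPermutational.congr {f g : n ⟶ m} [hf : IsPermutational f] (e : f ≅ g) :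
    IsPermutational g :=
  let ⟨σ, h⟩ := hf.exists_isPerm
  ⟨σ, h.congr e⟩

section

variable {f g h : n ⟶ m} [hf : IsPermutational f]

lemma coefUnit_ext {T T' : f ⟶ g} [IsIso T] [IsIso T'] (h : coefUnit T = coefUnit T') : T = T' := by
  obtain ⟨σ, hf⟩ := hf.exists_isPerm
  refine hom₂_ext hf (hf.congr (asIso T)) (funext fun i => ?_)
  rw [← val_coefUnit hf, ← val_coefUnit hf, h]

lemma coefUnit_id : coefUnit (𝟙 f) = 1 := by
  obtain ⟨σ, hf⟩ := hf.exists_isPerm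
  funext i
  apply Units.ext
  rw [val_coefUnit hf, coef_id hf]
  rfl

lemma coefUnit_eqToHom (h : f = g) : coefUnit (eqToHom h) = 1 := by
  subst h
  exact coefUnit_id

lemma coefUnit_comp (T : f ⟶ g) (U : g ⟶ h) [IsIso T] [IsIso U] :
    coefUnit (T ≫ U) = coefUnit T * coefUnit U := by
  obtain ⟨σ, hf⟩ := hf.exists_isPerm
  have hg := hf.congr (asIso T)
  funext i
  apply Units.ext
  rw [val_coefUnit hf, coef_comp hf hg (hg.congr (asIso U)), Pi.mul_apply, Pi.mul_apply,
    Units.val_mul, val_coefUnit hf, val_coefUnit hg]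

lemma coefUnit_iso_inv (e : f ≅ g) : coefUnit e.inv = (coefUnit e.hom)⁻¹ := by
  rw [eq_inv_iff_mul_eq_one]
  have := IsPermutational.congr e
  rw [← coefUnit_comp, e.inv_hom_id, coefUnit_id]

lemma coefUnit_whiskerLeft {g g' : m ⟶ p} (U : g ⟶ g') : coefUnit (f ◁ U) = coefUnit U := by
  obtain ⟨σ, hf⟩ := hf.exists_isPerm
  funext k
  simp only [coefUnit, coef_whiskerLeft hf]

lemma coefUnit_whiskerRight {k : m ⟶ p} {τ : Fin m.dim ≃ Fin p.dim} (hk : IsPerm k τ) (T : f ⟶ g)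
    [IsIso T] : coefUnit (T ▷ k) = coordPerm τ (coefUnit T) := by
  obtain ⟨σ, hf⟩ := hf.exists_isPerm
  funext i
  simp only [coefUnit, coef_whiskerRight hf (hf.congr (asIso T)) hk, coordPerm_apply]

lemma coefUnit_leftUnitor_hom : coefUnit (λ_ f).hom = 1 :=
  coefUnit_eqToHom (f := 𝟙 n ≫ f) (Hom.id_comp f)

lemma coefUnit_leftUnitor_inv : coefUnit (λ_ f).inv = 1 :=
  coefUnit_eqToHom (Hom.id_comp f).symm

lemma coefUnit_rightUnitor_hom : coefUnit (ρ_ f).hom = 1 :=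
  coefUnit_eqToHom (f := f ≫ 𝟙 m) (Hom.comp_id f)

lemma coefUnit_rightUnitor_inv : coefUnit (ρ_ f).inv = 1 :=
  coefUnit_eqToHom (Hom.comp_id f).symm

lemma coefUnit_associator_hom {q : TwoMat} {k : m ⟶ p} {l : p ⟶ q} [IsPermutational k]
    [IsPermutational l] : coefUnit (α_ f k l).hom = 1 :=
  coefUnit_eqToHom (f := (f ≫ k) ≫ l) (Hom.comp_assoc f k l)

lemma coefUnit_associator_inv {q : TwoMat} {k : m ⟶ p} {l : p ⟶ q} [IsPermutational k]
    [IsPermutational l] : coefUnit (α_ f k l).inv = 1 :=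
  coefUnit_eqToHom (f := f ≫ k ≫ l) (Hom.comp_assoc f k l).symm

end

section

variable {σ : Fin n.dim ≃ Fin m.dim}

/-- The 2-morphism with given scalars. -/
def ofCoef (f g : n ⟶ m) (l : Fin m.dim → ℂ) : f ⟶ g := fun i _ => Matrix.of fun _ _ => l i

lemma coef_ofCoef {f g : n ⟶ m} (hf : IsPerm f σ) (hg : IsPerm g σ) (l : Fin m.dim → ℂ) :
    coef (ofCoef f g l) = l := by
  funext i
  obtain ⟨j, rfl⟩ := σ.surjective i
  have s : Fin (Hom.rank f (σ j) j) := ⟨0, by rw [hf.rank_self]; exact one_pos⟩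
  have t : Fin (Hom.rank g (σ j) j) := ⟨0, by rw [hg.rank_self]; exact one_pos⟩
  rw [coef_apply hf hg _ j t s]
  rfl

/-- The 2-isomorphism with given invertible scalars. -/
def isoOfCoef {f g : n ⟶ m} (hf : IsPerm f σ) (hg : IsPerm g σ) (l : Fin m.dim → ℂˣ) : f ≅ g where
  hom := ofCoef f g fun i => l i
  inv := ofCoef g f fun i => (l i)⁻¹
  hom_inv_id := hom₂_ext hf hf <| by
    rw [coef_comp hf hg hf, coef_ofCoef hf hg, coef_ofCoef hg hf, coef_id hf]
    funext i
    simp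
  inv_hom_id := hom₂_ext hg hg <| by
    rw [coef_comp hg hf hg, coef_ofCoef hf hg, coef_ofCoef hg hf, coef_id hg]
    funext i
    simp

lemma coefUnit_isoOfCoef {f g : n ⟶ m} (hf : IsPerm f σ) (hg : IsPerm g σ) (l : Fin m.dim → ℂˣ) :
    coefUnit (isoOfCoef hf hg l).hom = l := by
  funext i
  apply Units.ext
  rw [val_coefUnit hf]
  exact congrFun (coef_ofCoef hf hg fun i => (l i : ℂ)) i

end

/-- The entries of a 2-isomorphism between 1-morphisms with the same permutation matrix as rank
matrix are determined by its scalars. -/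
lemma forall_entry_eq_iff {n m : TwoMat} {f g : n ⟶ m} {σ : Fin n.dim ≃ Fin m.dim}
    (hf : IsPerm f σ) (T : f ⟶ g) [IsIso T] (l : Fin m.dim → ℂˣ) :
    (∀ j, entry T (σ j) j = Matrix.of fun _ _ => (l (σ j) : ℂ)) ↔ coefUnit T = l := by
  have hg := hf.congr (asIso T)
  constructor
  · intro h
    funext i
    obtain ⟨j, rfl⟩ := σ.surjective i
    have s : Fin (Hom.rank f (σ j) j) := ⟨0, by rw [hf.rank_self]; exact one_pos⟩
    have t : Fin (Hom.rank g (σ j) j) := ⟨0, by rw [hg.rank_self]; exact one_pos⟩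
    apply Units.ext
    rw [val_coefUnit hf, coef_apply hf hg T j t s, h]
    rfl
  · rintro rfl j
    ext t s
    rw [val_coefUnit hf, ← coef_apply hf hg T j t s]
    rfl

end TwoMat

/-! ### Differences of parallel morphisms in a 2-group, and choices of representatives -/

section TwoGroupTorsors

open MonoidalCategory

variable {G : Type u} [Category.{v} G] [MonoidalCategory G]

lemma gammaHom_mul_hom (A : G) (u w : Pi1 G) :
    (gammaHom A (u * w)).hom = (gammaHom A u).hom ≫ (gammaHom A w).hom := by
  rw [mul_comm, map_mul]
  rfl

lemma gammaHom_whiskerRight (A B : G) (u : Pi1 G) :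
    (gammaHom A u).hom ▷ B = (gammaHom (A ⊗ B) u).hom := by
  rw [gammaHom_hom, gammaHom_hom]; simp

lemma Pi0.mk_tensor (A B : G) : Pi0.mk (A ⊗ B) = Pi0.mk A * Pi0.mk B := rfl

lemma Pi0.mk_unit : Pi0.mk (𝟙_ G) = 1 := rfl

variable [IsTwoGroup G]

/-- The element `u` of `π₁(G)` with `φ = ψ ∘ γ_A(u)`. It exists because all morphisms of a 2-group
are invertible and `γ_A` is bijective. -/
def homDiff {A B : G} (φ ψ : A ⟶ B) : Pi1 G := (gamma A).symm (asIso φ ≪≫ (asIso ψ).symm)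

lemma gammaHom_homDiff {A B : G} (φ ψ : A ⟶ B) : (gammaHom A (homDiff φ ψ)).hom ≫ ψ = φ := by
  have h : gammaHom A (homDiff φ ψ) = asIso φ ≪≫ (asIso ψ).symm :=
    (gamma A).apply_symm_apply _
  rw [h]
  simp

lemma homDiff_eq {A B : G} {φ ψ : A ⟶ B} {u : Pi1 G} (h : φ = (gammaHom A u).hom ≫ ψ) :
    homDiff φ ψ = u := by
  apply (gammaHom_bijective A).1
  apply Iso.ext
  rw [← cancel_mono ψ, gammaHom_homDiff, h]

lemma homDiff_self {A B : G} (φ : A ⟶ B) : homDiff φ φ = 1 :=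
  homDiff_eq (by rw [map_one]; exact (Category.id_comp φ).symm)

lemma homDiff_mul {A B : G} (φ ψ χ : A ⟶ B) : homDiff φ ψ * homDiff ψ χ = homDiff φ χ :=
  (homDiff_eq (by rw [gammaHom_mul_hom, Category.assoc, gammaHom_homDiff, gammaHom_homDiff])).symm

lemma homDiff_inv {A B : G} (φ ψ : A ⟶ B) : (homDiff φ ψ)⁻¹ = homDiff ψ φ := by
  rw [inv_eq_iff_mul_eq_one, homDiff_mul, homDiff_self]

lemma homDiff_change {A B : G} (φ' ψ' φ ψ : A ⟶ B) :
    homDiff φ' ψ' = homDiff φ' φ * homDiff φ ψ * (homDiff ψ' ψ)⁻¹ := by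
  rw [homDiff_mul, homDiff_inv, homDiff_mul]

lemma homDiff_comp {A B C : G} (φ ψ : A ⟶ B) (φ' ψ' : B ⟶ C) :
    homDiff (φ ≫ φ') (ψ ≫ ψ') = homDiff φ ψ * homDiff φ' ψ' := by
  apply homDiff_eq
  have h := gammaHom_conj (asIso ψ) (homDiff φ' ψ')
  rw [asIso_hom] at h
  rw [gammaHom_mul_hom, Category.assoc, ← reassoc_of% h, gammaHom_homDiff,
    ← Category.assoc, gammaHom_homDiff]

lemma homDiff_comp_left {A B C : G} (χ : A ⟶ B) (φ ψ : B ⟶ C) :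
    homDiff (χ ≫ φ) (χ ≫ ψ) = homDiff φ ψ := by
  rw [homDiff_comp, homDiff_self, one_mul]

lemma homDiff_comp_right {A B C : G} (φ ψ : A ⟶ B) (χ : B ⟶ C) :
    homDiff (φ ≫ χ) (ψ ≫ χ) = homDiff φ ψ := by
  rw [homDiff_comp, homDiff_self, mul_one]

lemma homDiff_comp_gammaHom {A B : G} (φ : A ⟶ B) (u : Pi1 G) :
    homDiff (φ ≫ (gammaHom B u).hom) φ = u :=
  homDiff_eq (gammaHom_conj (asIso φ) u)

lemma homDiff_aut {A : G} (φ : Aut A) : homDiff φ.hom (𝟙 A) = (gamma A).symm φ :=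
  homDiff_eq (by
    rw [Category.comp_id]
    exact congrArg Iso.hom ((gamma A).apply_symm_apply φ).symm)

lemma whiskerLeft_gammaHom (A B : G) (u : Pi1 G) :
    A ◁ (gammaHom B u).hom = (gammaHom (A ⊗ B) (Pi0.mk A • u)).hom := by
  have h1 : A ◁ (gammaHom B u).hom = (deltaHom A u).hom ▷ B := by
    rw [gammaHom_hom, deltaHom_hom]; simp
  have h2 : gammaHom A (Pi0.mk A • u) = deltaHom A u := gamma_pi0Act A u
  rw [h1, ← h2, gammaHom_whiskerRight]

lemma homDiff_whiskerRight {A A' : G} (φ ψ : A ⟶ A') (B : G) :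
    homDiff (φ ▷ B) (ψ ▷ B) = homDiff φ ψ :=
  homDiff_eq (by
    rw [← gammaHom_whiskerRight, ← MonoidalCategory.comp_whiskerRight, gammaHom_homDiff])

lemma homDiff_whiskerLeft (A : G) {B B' : G} (φ ψ : B ⟶ B') :
    homDiff (A ◁ φ) (A ◁ ψ) = Pi0.mk A • homDiff φ ψ :=
  homDiff_eq (by
    rw [← whiskerLeft_gammaHom, ← MonoidalCategory.whiskerLeft_comp, gammaHom_homDiff])

end TwoGroupTorsors

section Skeleta

open MonoidalCategory

variable {G : Type u} [Category.{v} G] [MonoidalCategory G] [IsTwoGroup G]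

lemma Pi0.mk_eq_of_hom {A B : G} (φ : A ⟶ B) : Pi0.mk A = Pi0.mk B := Pi0.mk_eq (asIso φ)

namespace SkeletonData

variable (D : SkeletonData G)

/-- The value of the 3-cocycle compares the two ways of multiplying three representatives. -/
lemma cocycle_eq_homDiff (g h k : Pi0 G) {l m n : Pi0 G} (hl : g * h = l) (hm : h * k = m)
    (hn : l * k = n) (hn' : g * m = n) :
    D.cocycle g h k =
      homDiff ((α_ (D.obj g) (D.obj h) (D.obj k)).hom ≫ D.obj g ◁ (D.iso hm).hom ≫
        (D.iso hn').hom) ((D.iso hl).hom ▷ D.obj k ≫ (D.iso hn).hom) := by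
  subst hl hm hn
  symm
  apply homDiff_eq
  have h1 : gammaHom _ (D.cocycle g h k) = D.assocAut g h k :=
    (gamma _).apply_symm_apply _
  have h2 := gammaHom_conj
    (whiskerRightIso (D.iso (g := g) (h := h) rfl) (D.obj k) ≪≫ D.iso (g := g * h) (h := k) rfl)
    (D.cocycle g h k)
  rw [h1] at h2
  simp only [Iso.trans_hom, whiskerRightIso_hom] at h2
  rw [← h2]
  simp [assocAut]

/-- The choice with the same representatives as `D`, whose isomorphisms are composed with the
values of a normalized 2-cochain `b`. -/
def twist (b : Pi0 G → Pi0 G → Pi1 G) (hb : IsNormalized₂ b) : SkeletonData G where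
  obj := D.obj
  mk_obj := D.mk_obj
  obj_one := D.obj_one
  iso {g h k} hk := D.iso hk ≪≫ (show D.obj k ≅ D.obj k from gammaHom (D.obj k) (b g h))
  iso_one_left g := by
    rw [hb.one_left, map_one, ← D.iso_one_left]
    exact Category.comp_id _
  iso_one_right g := by
    rw [hb.one_right, map_one, ← D.iso_one_right]
    exact Category.comp_id _

lemma twist_cocycle (b : Pi0 G → Pi0 G → Pi1 G) (hb : IsNormalized₂ b) (g h k : Pi0 G) :
    (D.twist b hb).cocycle g h k =
      D.cocycle g h k * coboundary₂ (fun g u => g • u) b g h k := by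
  have e1 : homDiff ((α_ (D.obj g) (D.obj h) (D.obj k)).hom ≫
      D.obj g ◁ ((D.iso (k := h * k) rfl).hom ≫ (gammaHom _ (b h k)).hom) ≫
        (D.iso (mul_assoc g h k).symm).hom ≫ (gammaHom _ (b g (h * k))).hom)
      ((α_ (D.obj g) (D.obj h) (D.obj k)).hom ≫ D.obj g ◁ (D.iso (k := h * k) rfl).hom ≫
        (D.iso (mul_assoc g h k).symm).hom) = g • b h k * b g (h * k) := by
    rw [homDiff_comp_left, homDiff_comp, homDiff_whiskerLeft,
      homDiff_comp_gammaHom, homDiff_comp_gammaHom, D.mk_obj]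
  have e2 : homDiff (((D.iso (k := g * h) rfl).hom ≫ (gammaHom _ (b g h)).hom) ▷ D.obj k ≫
        (D.iso (k := g * h * k) rfl).hom ≫ (gammaHom _ (b (g * h) k)).hom)
      ((D.iso (k := g * h) rfl).hom ▷ D.obj k ≫ (D.iso (k := g * h * k) rfl).hom) =
      b g h * b (g * h) k := by
    rw [homDiff_comp, homDiff_whiskerRight, homDiff_comp_gammaHom, homDiff_comp_gammaHom]
  rw [cocycle_eq_homDiff (D.twist b hb) g h k rfl rfl rfl (mul_assoc g h k).symm,
    cocycle_eq_homDiff D g h k rfl rfl rfl (mul_assoc g h k).symm]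
  refine (homDiff_change _ _ _ _).trans
    (congrArg₂ (fun x y => x * _ * y⁻¹) e1 e2) |>.trans ?_
  rw [coboundary₂, mul_inv]
  simp only [mul_comm, mul_left_comm, mul_assoc]

lemma exists_cocycle_eq {α : Pi0 G → Pi0 G → Pi0 G → Pi1 G} (hα : IsClassifyingCocycle α) :
    ∃ D : SkeletonData G, D.cocycle = α := by
  obtain ⟨D, b, hb, h⟩ := hα
  refine ⟨D.twist b hb, ?_⟩
  funext g h' k
  rw [twist_cocycle, h]

open Classical in
/-- An isomorphism from an object to the representative of its class; it is the identity of the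
chosen representatives. -/
def frame (A : G) {g : Pi0 G} (h : Pi0.mk A = g) : A ≅ D.obj g :=
  if h' : A = D.obj g then eqToIso h' else
    Classical.choice (Quotient.exact (s := isIsomorphicSetoid G) (h.trans (D.mk_obj g).symm))

lemma frame_of_eq {A : G} {g : Pi0 G} (h : Pi0.mk A = g) (h' : A = D.obj g) :
    D.frame A h = eqToIso h' := dif_pos h'

lemma frame_obj (g : Pi0 G) : D.frame (D.obj g) (D.mk_obj g) = Iso.refl _ :=
  D.frame_of_eq _ rfl

lemma frame_unit : D.frame (𝟙_ G) Pi0.mk_unit = eqToIso D.obj_one.symm := D.frame_of_eq _ _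

/-- The isomorphism `A ⊗ B ≅ A_g ⊗ A_h ≅ A_{gh}`, where `g = [A]` and `h = [B]`. -/
def tensorFrame {A B : G} {g h k : Pi0 G} (hA : Pi0.mk A = g) (hB : Pi0.mk B = h)
    (hk : g * h = k) : A ⊗ B ≅ D.obj k :=
  (D.frame A hA ⊗ᵢ D.frame B hB) ≪≫ D.iso hk

lemma tensorFrame_hom {A B : G} {g h k : Pi0 G} (hA : Pi0.mk A = g) (hB : Pi0.mk B = h)
    (hk : g * h = k) : (D.tensorFrame hA hB hk).hom =
      (D.frame A hA).hom ▷ B ≫ D.obj g ◁ (D.frame B hB).hom ≫ (D.iso hk).hom := by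
  simp [tensorFrame, MonoidalCategory.tensorHom_def]

lemma tensorFrame_hom' {A B : G} {g h k : Pi0 G} (hA : Pi0.mk A = g) (hB : Pi0.mk B = h)
    (hk : g * h = k) : (D.tensorFrame hA hB hk).hom =
      A ◁ (D.frame B hB).hom ≫ (D.frame A hA).hom ▷ D.obj h ≫ (D.iso hk).hom := by
  simp [tensorFrame, MonoidalCategory.tensorHom_def']

end SkeletonData

end Skeleta

/-! ### The scalars of a representation -/

section ScalarRepresentations

open MonoidalCategory

variable (G : Type u) [Category.{v} G] [MonoidalCategory G] [IsTwoGroup G]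

/-- The scalars of an `n`-dimensional representation `F` of a 2-group on `2Mat_ℂ`: the rank matrix
of `F(A)` is the permutation matrix of `perm [A]`, and the 2-morphisms `F(φ)`,
`F(A ⊗ B) ⇒ F(A) ∘ F(B)` and `F(I) ⇒ id` have the scalars `map φ`, `mul A B` and `unit`. The
axioms are those of a pseudofunctor. -/
structure ScalarRep (n : ℕ) where
  perm : Pi0 G →* Equiv.Perm (Fin n)
  map {A B : G} (φ : A ⟶ B) : Fin n → ℂˣ
  mul (A B : G) : Fin n → ℂˣ
  unit : Fin n → ℂˣ
  map_id (A : G) : map (𝟙 A) = 1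
  map_comp {A B C : G} (φ : A ⟶ B) (ψ : B ⟶ C) : map (φ ≫ ψ) = map φ * map ψ
  map_whiskerLeft (A : G) {B B' : G} (φ : B ⟶ B') :
    map (A ◁ φ) = mul A B * coordPerm (perm (Pi0.mk A)) (map φ) * (mul A B')⁻¹
  map_whiskerRight {A A' : G} (φ : A ⟶ A') (B : G) :
    map (φ ▷ B) = mul A B * map φ * (mul A' B)⁻¹
  map_associator_inv (A B C : G) :
    map (α_ A B C).inv = mul A (B ⊗ C) * coordPerm (perm (Pi0.mk A)) (mul B C) *
      (mul A B)⁻¹ * (mul (A ⊗ B) C)⁻¹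
  map_leftUnitor_hom (A : G) : map (λ_ A).hom = mul (𝟙_ G) A * unit
  map_rightUnitor_hom (A : G) :
    map (ρ_ A).hom = mul A (𝟙_ G) * coordPerm (perm (Pi0.mk A)) unit

variable {G}

namespace TwoMatRep

open Bicategory TwoMat

variable (F : TwoMatRep G)

lemma exists_isPerm_map (A : G) :
    ∃ σ : Equiv.Perm (Fin F.dim), IsPerm (F.map (Deloop.hom A)) σ := by
  let B := (tensorLeft A).objPreimage (𝟙_ G)
  let C := (tensorRight A).objPreimage (𝟙_ G)
  let e : A ⊗ B ≅ 𝟙_ G := (tensorLeft A).objObjPreimageIso (𝟙_ G)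
  let e' : C ⊗ A ≅ 𝟙_ G := (tensorRight A).objObjPreimageIso (𝟙_ G)
  -- A right inverse is also a left inverse.
  let e'' : B ⊗ A ≅ 𝟙_ G :=
    whiskerRightIso ((λ_ B).symm ≪≫ whiskerRightIso e'.symm B ≪≫ α_ C A B ≪≫ whiskerLeftIso C e ≪≫
      ρ_ C) A ≪≫ e'
  have k (X Y : G) (i : X ⊗ Y ≅ 𝟙_ G) :
      F.map (Deloop.hom Y) ≫ F.map (Deloop.hom X) ≅ 𝟙 (F.obj Deloop.star) :=
    (F.mapComp (Deloop.hom Y) (Deloop.hom X)).symm ≪≫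
      F.map₂Iso (show Deloop.hom Y ≫ Deloop.hom X ≅ 𝟙 Deloop.star from i) ≪≫ F.mapId Deloop.star
  exact exists_isPerm (k B A e'') (k A B e)

instance {a b : Deloop G} (f : a ⟶ b) : IsPermutational (F.map f) := ⟨F.exists_isPerm_map f⟩

/-- The permutation whose matrix is the rank matrix of `F(A)`. -/
def objPerm (A : G) : Equiv.Perm (Fin F.dim) := (F.exists_isPerm_map A).choose

lemma isPerm_objPerm (A : G) : IsPerm (F.map (Deloop.hom A)) (F.objPerm A) :=
  (F.exists_isPerm_map A).choose_spec

lemma objPerm_congr {A B : G} (e : A ≅ B) : F.objPerm A = F.objPerm B :=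
  ((F.isPerm_objPerm A).congr
    (F.map₂Iso (show Deloop.hom A ≅ Deloop.hom B from e))).unique (F.isPerm_objPerm B)

/-- The action of `π₀(G)` on the coordinates of `F`. -/
def perm : Pi0 G →* Equiv.Perm (Fin F.dim) where
  toFun := Quotient.lift F.objPerm fun _ _ ⟨e⟩ => F.objPerm_congr e
  map_one' := (F.isPerm_objPerm (𝟙_ G)).unique
    ((IsPerm.id (F.obj Deloop.star)).congr (F.mapId Deloop.star).symm)
  map_mul' g h := by
    induction g, h using Quotient.inductionOn₂ with
    | _ A B =>
    exact (F.isPerm_objPerm (A ⊗ B)).unique (((F.isPerm_objPerm B).comp (F.isPerm_objPerm A)).congr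
      (F.mapComp (Deloop.hom B) (Deloop.hom A)).symm)

lemma isPerm_map (A : G) : IsPerm (F.map (Deloop.hom A)) (F.perm (Pi0.mk A)) := F.isPerm_objPerm A

instance {a b : Deloop G} {f g : a ⟶ b} (φ : f ⟶ g) : IsIso φ :=
  inferInstanceAs (IsIso (X := (f : G)) (Y := (g : G)) φ)

/-- The scalars of a representation. -/
def scalarRep : ScalarRep G F.dim where
  perm := F.perm
  map φ := coefUnit (F.map₂ (Deloop.hom₂ φ))
  mul A B := coefUnit (F.mapComp (Deloop.hom B) (Deloop.hom A)).hom
  unit := coefUnit (F.mapId Deloop.star).hom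
  map_id A := by
    refine (congrArg coefUnit (F.map₂_id (Deloop.hom A))).trans coefUnit_id
  map_comp φ ψ := by
    refine (congrArg coefUnit (F.map₂_comp (Deloop.hom₂ φ) (Deloop.hom₂ ψ))).trans ?_
    exact coefUnit_comp _ _
  map_whiskerLeft A B B' φ := by
    refine (congrArg coefUnit (F.map₂_whisker_right (Deloop.hom₂ φ) (Deloop.hom A))).trans ?_
    rw [coefUnit_comp, coefUnit_comp, coefUnit_whiskerRight (F.isPerm_map A), coefUnit_iso_inv]
    exact (mul_assoc _ _ _).symm
  map_whiskerRight {A A'} φ B := by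
    refine (congrArg coefUnit (F.map₂_whisker_left (Deloop.hom B) (Deloop.hom₂ φ))).trans ?_
    rw [coefUnit_comp, coefUnit_comp, coefUnit_whiskerLeft, coefUnit_iso_inv]
    exact (mul_assoc _ _ _).symm
  map_associator_inv A B C := by
    refine (congrArg coefUnit
      (F.map₂_associator (Deloop.hom C) (Deloop.hom B) (Deloop.hom A))).trans ?_
    rw [coefUnit_comp, coefUnit_comp, coefUnit_comp, coefUnit_comp,
      coefUnit_whiskerRight (F.isPerm_map A), coefUnit_whiskerLeft, coefUnit_iso_inv,
      coefUnit_iso_inv, coefUnit_associator_hom, one_mul]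
    exact (mul_assoc _ _ _).symm.trans (mul_assoc _ _ _).symm |>.trans (by rfl)
  map_leftUnitor_hom A := by
    refine (congrArg coefUnit (F.map₂_right_unitor (Deloop.hom A))).trans ?_
    rw [coefUnit_comp, coefUnit_comp, coefUnit_whiskerLeft, coefUnit_rightUnitor_hom, mul_one]
    rfl
  map_rightUnitor_hom A := by
    refine (congrArg coefUnit (F.map₂_left_unitor (Deloop.hom A))).trans ?_
    rw [coefUnit_comp, coefUnit_comp, coefUnit_whiskerRight (F.isPerm_map A),
      coefUnit_leftUnitor_hom, mul_one]
    rfl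

end TwoMatRep

end ScalarRepresentations

/-! ### Representations with given scalars, and equivalence of scalars -/

section Realization

open MonoidalCategory

variable {G : Type u} [Category.{v} G] [MonoidalCategory G] [IsTwoGroup G]

namespace ScalarRep

open Bicategory TwoMat

variable {n : ℕ} (S : ScalarRep G n)

/-- The 1-morphism `F(A)` of the representation with scalars `S`. -/
def obj₁ (A : G) : TwoMat.mk n ⟶ TwoMat.mk n := ofEquiv (S.perm (Pi0.mk A))

lemma isPerm_obj₁ (A : G) : IsPerm (S.obj₁ A) (S.perm (Pi0.mk A)) := isPerm_ofEquiv _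

instance (A : G) : IsPermutational (S.obj₁ A) := ⟨_, S.isPerm_obj₁ A⟩

/-- The 2-isomorphism `F(φ)` of the representation with scalars `S`. -/
def iso₂ {A B : G} (φ : A ⟶ B) : S.obj₁ A ≅ S.obj₁ B :=
  isoOfCoef (S.isPerm_obj₁ A) (by rw [Pi0.mk_eq_of_hom φ]; exact S.isPerm_obj₁ B) (S.map φ)

lemma coefUnit_iso₂ {A B : G} (φ : A ⟶ B) : coefUnit (S.iso₂ φ).hom = S.map φ :=
  coefUnit_isoOfCoef _ _ _

/-- The 2-isomorphism `F(A ⊗ B) ⇒ F(A) ∘ F(B)` of the representation with scalars `S`. -/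
def isoMul (A B : G) : S.obj₁ (A ⊗ B) ≅ S.obj₁ B ≫ S.obj₁ A :=
  isoOfCoef (S.isPerm_obj₁ (A ⊗ B))
    (by rw [Pi0.mk_tensor, map_mul]; exact (S.isPerm_obj₁ B).comp (S.isPerm_obj₁ A)) (S.mul A B)

lemma coefUnit_isoMul (A B : G) : coefUnit (S.isoMul A B).hom = S.mul A B :=
  coefUnit_isoOfCoef _ _ _

/-- The 2-isomorphism `F(I) ⇒ id` of the representation with scalars `S`. -/
def isoUnit : S.obj₁ (𝟙_ G) ≅ 𝟙 (TwoMat.mk n) :=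
  isoOfCoef (σ := 1) (by rw [← map_one S.perm]; exact S.isPerm_obj₁ (𝟙_ G)) (IsPerm.id _) S.unit

lemma coefUnit_isoUnit : coefUnit S.isoUnit.hom = S.unit :=
  coefUnit_isoOfCoef _ _ _

/-- The representation with scalars `S` and with trivial gauges. -/
def toRep : TwoMatRep G where
  obj _ := ⟨n⟩
  map A := S.obj₁ A
  map₂ φ := (S.iso₂ φ).hom
  map₂_id A := coefUnit_ext <| by
    rw [coefUnit_iso₂, coefUnit_id]; exact S.map_id A
  map₂_comp φ ψ := coefUnit_ext <| by
    rw [coefUnit_comp, coefUnit_iso₂, coefUnit_iso₂, coefUnit_iso₂]; exact S.map_comp φ ψ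
  mapId _ := S.isoUnit
  mapComp A B := S.isoMul B A
  map₂_whisker_left {_ _ _} B {A A'} φ := coefUnit_ext <| by
    rw [coefUnit_comp, coefUnit_comp, coefUnit_whiskerLeft, coefUnit_iso_inv, coefUnit_iso₂,
      coefUnit_iso₂, coefUnit_isoMul, coefUnit_isoMul]
    exact (S.map_whiskerRight φ B).trans (mul_assoc _ _ _)
  map₂_whisker_right {_ _ _ B B'} φ A := coefUnit_ext <| by
    rw [coefUnit_comp, coefUnit_comp, coefUnit_whiskerRight (S.isPerm_obj₁ A), coefUnit_iso_inv,
      coefUnit_iso₂, coefUnit_iso₂, coefUnit_isoMul, coefUnit_isoMul]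
    exact (S.map_whiskerLeft A φ).trans (mul_assoc _ _ _)
  map₂_associator {_ _ _ _} C B A := coefUnit_ext <| by
    rw [coefUnit_comp, coefUnit_comp, coefUnit_comp, coefUnit_comp,
      coefUnit_whiskerRight (S.isPerm_obj₁ A), coefUnit_whiskerLeft, coefUnit_iso_inv,
      coefUnit_iso_inv, coefUnit_associator_hom, one_mul, coefUnit_iso₂, coefUnit_isoMul,
      coefUnit_isoMul, coefUnit_isoMul, coefUnit_isoMul]
    exact (S.map_associator_inv A B C).trans
      ((mul_assoc _ _ _).trans (mul_assoc _ _ _))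
  map₂_left_unitor {_ _} A := coefUnit_ext <| by
    rw [coefUnit_comp, coefUnit_comp, coefUnit_whiskerRight (S.isPerm_obj₁ A),
      coefUnit_leftUnitor_hom, mul_one, coefUnit_iso₂, coefUnit_isoMul, coefUnit_isoUnit]
    exact S.map_rightUnitor_hom A
  map₂_right_unitor {_ _} A := coefUnit_ext <| by
    rw [coefUnit_comp, coefUnit_comp, coefUnit_whiskerLeft,
      coefUnit_rightUnitor_hom, mul_one, coefUnit_iso₂, coefUnit_isoMul, coefUnit_isoUnit]
    exact S.map_leftUnitor_hom A

/-- Equality of the scalars of equivalent representations, up to a permutation `σ` of the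
coordinates and up to the scalars `x A` of the naturality 2-isomorphism at `A` of the equivalence. -/
structure Equivalence {n n' : ℕ} (S : ScalarRep G n) (S' : ScalarRep G n') where
  σ : Fin n ≃ Fin n'
  x : G → Fin n' → ℂˣ
  perm_comm (g : Pi0 G) : (S.perm g).trans σ = σ.trans (S'.perm g)
  naturality {A B : G} (φ : A ⟶ B) : coordPerm σ (S.map φ) * x B = x A * S'.map φ
  tensor (A B : G) : x (A ⊗ B) * S'.mul A B =
    coordPerm σ (S.mul A B) * x A * coordPerm (S'.perm (Pi0.mk A)) (x B)

namespace Equivalence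

variable {n' : ℕ} {S} {S' : ScalarRep G n'} (E : Equivalence S S')

lemma coordPerm_comm (g : Pi0 G) (l : Fin n → ℂˣ) :
    coordPerm E.σ (coordPerm (S.perm g) l) = coordPerm (S'.perm g) (coordPerm E.σ l) := by
  rw [← coordPerm_trans, E.perm_comm, coordPerm_trans]

/-- Compatibility with the unit follows from the compatibility with the tensor product `I ⊗ I`. -/
lemma unit_eq : E.x (𝟙_ G) * S'.unit = coordPerm E.σ S.unit := by
  have h1 := E.naturality (λ_ (𝟙_ G)).hom
  have h2 := E.tensor (𝟙_ G) (𝟙_ G)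
  rw [S.map_leftUnitor_hom, S'.map_leftUnitor_hom, map_mul] at h1
  rw [Pi0.mk_unit, map_one, coordPerm_one] at h2
  -- In additive notation, identities in abelian groups are decided by linear arithmetic.
  apply Additive.ofMul.injective
  replace h1 := congrArg Additive.ofMul h1
  replace h2 := congrArg Additive.ofMul h2
  simp only [ofMul_mul] at *
  grind

/-- The inverse equivalence. -/
def symm : Equivalence S' S where
  σ := E.σ.symm
  x A := coordPerm E.σ.symm (E.x A)⁻¹
  perm_comm g := by
    ext i : 1
    have h := congrArg (fun f => E.σ.symm (f (E.σ.symm i))) (E.perm_comm g)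
    simpa using h.symm
  naturality {A B} φ := by
    have h := congrArg (coordPerm E.σ.symm) (E.naturality φ)
    simp only [map_mul, coordPerm_apply_symm, map_inv] at h ⊢
    apply Additive.ofMul.injective
    replace h := congrArg Additive.ofMul h
    simp only [ofMul_mul, ofMul_inv] at *
    grind
  tensor A B := by
    have h := congrArg (coordPerm E.σ.symm) (E.tensor A B)
    have h' := E.coordPerm_comm (Pi0.mk A) (coordPerm E.σ.symm (E.x B))
    rw [coordPerm_symm_apply] at h'
    rw [← h'] at h
    simp only [map_mul, coordPerm_apply_symm, map_inv] at h ⊢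
    apply Additive.ofMul.injective
    replace h := congrArg Additive.ofMul h
    simp only [ofMul_mul, ofMul_inv] at *
    grind

end Equivalence

end ScalarRep

end Realization

/-! ### Equivalence of representations and equivalence of their scalars -/

section Transformations

variable {G : Type u} [Category.{v} G] [MonoidalCategory G] [IsTwoGroup G]

namespace ScalarRep.Equivalence

open Bicategory TwoMat

variable {F F' : TwoMatRep G} (E : Equivalence F.scalarRep F'.scalarRep)

/-- The component of the pseudonatural transformation defined by an equivalence of scalars. -/
def app : F.obj Deloop.star ⟶ F'.obj Deloop.star := ofEquiv E.σ

lemma isPerm_app : IsPerm E.app E.σ := isPerm_ofEquiv _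

instance : IsPermutational E.app := ⟨_, E.isPerm_app⟩

/-- The naturality 2-isomorphisms of the pseudonatural transformation defined by an equivalence of
scalars. -/
def natIso (A : (Deloop.star : Deloop G) ⟶ Deloop.star) :
    F.map A ≫ E.app ≅ E.app ≫ F'.map A :=
  isoOfCoef ((F.isPerm_map A).comp E.isPerm_app)
    (by
      have h := E.perm_comm (Pi0.mk (H := G) A)
      exact h ▸ E.isPerm_app.comp (F'.isPerm_map A)) (E.x A)

lemma coefUnit_natIso (A : (Deloop.star : Deloop G) ⟶ Deloop.star) :
    coefUnit (E.natIso A).hom = E.x A := coefUnit_isoOfCoef _ _ _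

lemma natIso_naturality {A B : (Deloop.star : Deloop G) ⟶ Deloop.star} (φ : A ⟶ B) :
    F.map₂ φ ▷ E.app ≫ (E.natIso B).hom = (E.natIso A).hom ≫ E.app ◁ F'.map₂ φ :=
  coefUnit_ext <| by
    rw [coefUnit_comp, coefUnit_comp, coefUnit_whiskerRight E.isPerm_app, coefUnit_whiskerLeft,
      coefUnit_natIso, coefUnit_natIso]
    exact E.naturality (A := A) (B := B) φ

lemma natIso_id :
    (E.natIso (𝟙 Deloop.star)).hom ≫ E.app ◁ (F'.mapId Deloop.star).hom =
      (F.mapId Deloop.star).hom ▷ E.app ≫ (λ_ E.app).hom ≫ (ρ_ E.app).inv :=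
  coefUnit_ext <| by
    rw [coefUnit_comp, coefUnit_comp, coefUnit_comp, coefUnit_whiskerRight E.isPerm_app,
      coefUnit_whiskerLeft, coefUnit_leftUnitor_hom, coefUnit_rightUnitor_inv, coefUnit_natIso]
    exact E.unit_eq.trans (by rw [one_mul, mul_one]; rfl)

lemma natIso_comp (B A : (Deloop.star : Deloop G) ⟶ Deloop.star) :
    (E.natIso (B ≫ A)).hom ≫ E.app ◁ (F'.mapComp B A).hom =
      (F.mapComp B A).hom ▷ E.app ≫ (α_ _ _ _).hom ≫
        F.map B ◁ (E.natIso A).hom ≫ (α_ _ _ _).inv ≫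
          (E.natIso B).hom ▷ F'.map A ≫ (α_ _ _ _).hom := coefUnit_ext <| by
  rw [coefUnit_comp, coefUnit_comp, coefUnit_comp, coefUnit_comp, coefUnit_comp, coefUnit_comp,
    coefUnit_whiskerRight E.isPerm_app, coefUnit_whiskerRight (k := F'.map A) (F'.isPerm_map A),
    coefUnit_whiskerLeft, coefUnit_whiskerLeft, coefUnit_associator_hom, coefUnit_associator_hom,
    coefUnit_associator_inv, one_mul, one_mul, mul_one, coefUnit_natIso, coefUnit_natIso,
    coefUnit_natIso]
  exact (E.tensor A B).trans (mul_assoc _ _ _)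

/-- The pseudonatural transformation defined by an equivalence of scalars. -/
def toStrongTrans : Pseudofunctor.StrongTrans F F' where
  app _ := E.app
  naturality A := E.natIso A
  naturality_naturality {_ _ A B} φ := E.natIso_naturality (A := A) (B := B) φ
  naturality_id _ := E.natIso_id
  naturality_comp B A := E.natIso_comp B A

open scoped Pseudofunctor.StrongTrans

lemma isPerm_app_comp : IsPerm (E.app ≫ E.symm.app) (Equiv.refl _) := by
  have h := E.isPerm_app.comp E.symm.isPerm_app
  have e : E.σ.trans E.symm.σ = Equiv.refl _ := E.σ.self_trans_symm
  exact e ▸ h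

/-- The component of the isomorphism `compSymmIso`. -/
def appCompIso : E.app ≫ E.symm.app ≅ 𝟙 (F.obj Deloop.star) :=
  isoOfCoef E.isPerm_app_comp (IsPerm.id _) 1

lemma coefUnit_appCompIso : coefUnit E.appCompIso.hom = 1 := coefUnit_isoOfCoef _ _ _

lemma appCompIso_naturality (A : (Deloop.star : Deloop G) ⟶ Deloop.star) :
    F.map A ◁ E.appCompIso.hom ≫ (ρ_ (F.map A)).hom ≫ (λ_ (F.map A)).inv =
      ((α_ _ _ _).inv ≫ (E.natIso A).hom ▷ E.symm.app ≫ (α_ _ _ _).hom ≫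
        E.app ◁ (E.symm.natIso A).hom ≫ (α_ _ _ _).inv) ≫ E.appCompIso.hom ▷ F.map A :=
  coefUnit_ext <| by
    rw [coefUnit_comp, coefUnit_comp, coefUnit_comp, coefUnit_comp, coefUnit_comp, coefUnit_comp,
      coefUnit_comp, coefUnit_whiskerLeft, coefUnit_whiskerLeft,
      coefUnit_whiskerRight (k := F.map A) (F.isPerm_map A),
      coefUnit_whiskerRight (k := E.symm.app) E.symm.isPerm_app, coefUnit_associator_hom,
      coefUnit_associator_inv, coefUnit_associator_inv, coefUnit_rightUnitor_hom,
      coefUnit_leftUnitor_inv, coefUnit_natIso, coefUnit_natIso, coefUnit_appCompIso, map_one]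
    simp only [one_mul, mul_one]
    have h : coordPerm E.symm.σ (E.x A) * (coordPerm E.symm.σ (E.x A)⁻¹ * 1) = 1 := by
      rw [mul_one, ← map_mul, mul_inv_cancel, map_one]
    exact h.symm

/-- The composite of the transformations defined by `E` and by its inverse is isomorphic to the
identity, because the product of their scalars is 1. -/
def compSymmIso :
    (show F ⟶ F' from E.toStrongTrans) ≫ (show F' ⟶ F from E.symm.toStrongTrans) ≅ 𝟙 F :=
  Pseudofunctor.StrongTrans.isoMk (fun _ => E.appCompIso)
    (fun {_ _} A => by
      rw [Pseudofunctor.StrongTrans.categoryStruct_comp_naturality_hom,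
        Pseudofunctor.StrongTrans.categoryStruct_id_naturality_hom]
      exact E.appCompIso_naturality A)

lemma symm_symm : E.symm.symm = E := by
  obtain ⟨σ, x, -, -, -⟩ := E
  simp only [symm, mk.injEq, Equiv.symm_symm, true_and]
  funext A
  rw [← map_inv, inv_inv, coordPerm_symm_apply]

lemma areEquivalent {F F' : TwoMatRep G} (E : Equivalence F.scalarRep F'.scalarRep) :
    AreEquivalent F F' := by
  have h := E.symm.compSymmIso
  rw [symm_symm] at h
  exact ⟨E.toStrongTrans, E.symm.toStrongTrans, ⟨E.compSymmIso⟩, ⟨h⟩⟩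

end ScalarRep.Equivalence

namespace TwoMatRep

open Bicategory TwoMat

variable {F F' : TwoMatRep G}

open scoped Pseudofunctor.StrongTrans

/-- An equivalence of representations defines an equivalence of their scalars: the component of
the transformation is an equivalence in `2Mat_ℂ`, hence has a permutation matrix as rank matrix. -/
lemma nonempty_equivalence (h : AreEquivalent F F') :
    Nonempty (ScalarRep.Equivalence F.scalarRep F'.scalarRep) := by
  obtain ⟨η, θ, ⟨e⟩, ⟨e'⟩⟩ := h
  have ap {K : TwoMatRep G} {κ ν : K ⟶ K} (i : κ ≅ ν) :
      κ.app Deloop.star ≅ ν.app Deloop.star :=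
    { hom := i.hom.as.app Deloop.star
      inv := i.inv.as.app Deloop.star
      hom_inv_id := congrArg (fun m => m.as.app Deloop.star) i.hom_inv_id
      inv_hom_id := congrArg (fun m => m.as.app Deloop.star) i.inv_hom_id }
  obtain ⟨σ, hσ⟩ := exists_isPerm (f := η.app Deloop.star) (g := θ.app Deloop.star) (ap e) (ap e')
  have : IsPermutational (η.app Deloop.star) := ⟨σ, hσ⟩
  refine ⟨⟨σ, fun A => coefUnit (η.naturality (Deloop.hom A)).hom, fun g => ?_, fun {A B} φ => ?_,
    fun A B => ?_⟩⟩
  · induction g using Quotient.inductionOn with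
    | _ A =>
    exact (((F.isPerm_map A).comp hσ).congr (η.naturality (Deloop.hom A))).unique
      (hσ.comp (F'.isPerm_map A))
  · have h := congrArg coefUnit (η.naturality_naturality (Deloop.hom₂ φ))
    rw [coefUnit_comp, coefUnit_comp, coefUnit_whiskerRight hσ, coefUnit_whiskerLeft] at h
    exact h
  · have h := congrArg coefUnit (η.naturality_comp (Deloop.hom B) (Deloop.hom A))
    rw [coefUnit_comp, coefUnit_comp, coefUnit_comp, coefUnit_comp, coefUnit_comp, coefUnit_comp,
      coefUnit_whiskerRight hσ,
      coefUnit_whiskerRight (k := F'.map (Deloop.hom A)) (F'.isPerm_map A),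
      coefUnit_whiskerLeft, coefUnit_whiskerLeft, coefUnit_associator_hom, coefUnit_associator_hom,
      coefUnit_associator_inv, one_mul, one_mul, mul_one] at h
    exact h.trans (mul_assoc _ _ _).symm

lemma areEquivalent_iff :
    AreEquivalent F F' ↔ Nonempty (ScalarRep.Equivalence F.scalarRep F'.scalarRep) :=
  ⟨nonempty_equivalence, fun ⟨E⟩ => E.areEquivalent⟩

end TwoMatRep

end Transformations

/-! ### The data of a representation -/

section Cochains

open MonoidalCategory

variable {G : Type u} [Category.{v} G] [MonoidalCategory G] [IsTwoGroup G]

namespace ScalarRep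

variable {n n' : ℕ} (S : ScalarRep G n) (S' : ScalarRep G n') (D : SkeletonData G)

lemma map_inv {A B : G} (e : A ≅ B) : S.map e.inv = (S.map e.hom)⁻¹ := by
  rw [eq_inv_iff_mul_eq_one, ← S.map_comp, e.inv_hom_id, S.map_id]

/-- The homomorphism `β : π₁(G) → (ℂ*)ⁿ` of scalars of automorphisms of the unit object. -/
def character : Pi1 G →* (Fin n → ℂˣ) where
  toFun u := S.map u.hom
  map_one' := S.map_id _
  map_mul' u w := (S.map_comp w.hom u.hom).trans (mul_comm _ _)

lemma map_gammaHom (A : G) (u : Pi1 G) : S.map (gammaHom A u).hom = S.character u := by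
  have h : S.character u = S.map u.hom := rfl
  rw [gammaHom_hom, S.map_comp, S.map_comp, S.map_whiskerRight, S.map_inv, mul_inv_cancel_comm, h,
    mul_comm, mul_assoc, mul_inv_cancel, mul_one]

lemma map_deltaHom (A : G) (u : Pi1 G) :
    S.map (deltaHom A u).hom = coordPerm (S.perm (Pi0.mk A)) (S.character u) := by
  have h : S.character u = S.map u.hom := rfl
  rw [deltaHom_hom, S.map_comp, S.map_comp, S.map_whiskerLeft, S.map_inv, mul_inv_cancel_comm, h,
    mul_comm, mul_assoc, mul_inv_cancel, mul_one]

lemma character_smul (g : Pi0 G) (u : Pi1 G) :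
    S.character (g • u) = coordPerm (S.perm g) (S.character u) := by
  induction g using Quotient.inductionOn with
  | _ A =>
  have h : gammaHom A (Pi0.mk A • u) = deltaHom A u := gamma_pi0Act A u
  exact (S.map_gammaHom A _).symm.trans
    ((congrArg (fun φ => S.map φ.hom) h).trans (S.map_deltaHom A u))

lemma map_eq_character_mul {A B : G} (φ ψ : A ⟶ B) :
    S.map φ = S.character (homDiff φ ψ) * S.map ψ := by
  rw [← S.map_gammaHom A, ← S.map_comp, gammaHom_homDiff]

/-- The 2-cochain of scalars of the composites `F(A_g) ∘ F(A_h) ⇒ F(A_g ⊗ A_h) ⇒ F(A_{gh})`. It need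
not be normalized, because the isomorphism `F(I) ⇒ id` may have arbitrary scalars. -/
def cochain (g h : Pi0 G) : Fin n → ℂˣ :=
  (S.mul (D.obj g) (D.obj h))⁻¹ * S.map (D.iso (g := g) (h := h) rfl).hom

lemma map_iso {g h k : Pi0 G} (hk : g * h = k) :
    S.map (D.iso hk).hom = S.mul (D.obj g) (D.obj h) * S.cochain D g h := by
  subst hk
  rw [cochain, mul_inv_cancel_left]

lemma map_tensorFrame {A B : G} {g h k : Pi0 G} (hA : Pi0.mk A = g) (hB : Pi0.mk B = h)
    (hk : g * h = k) : S.map (D.tensorFrame hA hB hk).hom =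
      S.mul A B * S.map (D.frame A hA).hom *
        coordPerm (S.perm g) (S.map (D.frame B hB).hom) * S.cochain D g h := by
  rw [SkeletonData.tensorFrame_hom, S.map_comp, S.map_comp, S.map_whiskerRight, S.map_whiskerLeft, S.map_iso, D.mk_obj]
  apply Additive.ofMul.injective
  simp only [ofMul_mul, ofMul_inv]
  grind

lemma coboundary_cochain (g h k : Pi0 G) :
    coboundary₂ (fun g => permAct (S.perm g)) (S.cochain D) g h k =
      S.character (D.cocycle g h k) := by
  have e := S.map_eq_character_mul
    ((α_ (D.obj g) (D.obj h) (D.obj k)).hom ≫ D.obj g ◁ (D.iso (k := h * k) rfl).hom ≫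
      (D.iso (mul_assoc g h k).symm).hom)
    ((D.iso (k := g * h) rfl).hom ▷ D.obj k ≫ (D.iso (k := g * h * k) rfl).hom)
  rw [← D.cocycle_eq_homDiff] at e
  have a := S.map_inv (α_ (D.obj g) (D.obj h) (D.obj k))
  rw [S.map_associator_inv] at a
  simp only [S.map_comp, S.map_whiskerLeft, S.map_whiskerRight, S.map_iso, D.mk_obj, map_mul]
    at e a
  rw [coboundary₂, permAct_eq_coordPerm]
  apply Additive.ofMul.injective
  replace e := congrArg Additive.ofMul e
  replace a := congrArg Additive.ofMul a
  simp only [ofMul_mul, ofMul_inv] at *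
  grind

lemma map_eqToHom_obj_one :
    S.map (eqToHom D.obj_one) * S.unit = S.cochain D 1 1 := by
  have h := S.map_iso D (one_mul 1)
  rw [D.iso_one_left, S.map_comp, S.map_whiskerRight, S.map_leftUnitor_hom] at h
  apply Additive.ofMul.injective
  replace h := congrArg Additive.ofMul h
  simp only [ofMul_mul, ofMul_inv] at *
  grind

lemma cochain_one_left (g : Pi0 G) : S.cochain D 1 g = S.cochain D 1 1 := by
  have h := S.map_iso D (one_mul g)
  rw [D.iso_one_left, S.map_comp, S.map_whiskerRight, S.map_leftUnitor_hom] at h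
  rw [← map_eqToHom_obj_one]
  apply Additive.ofMul.injective
  replace h := congrArg Additive.ofMul h
  simp only [ofMul_mul, ofMul_inv] at *
  grind

lemma cochain_one_right (g : Pi0 G) :
    S.cochain D g 1 = coordPerm (S.perm g) (S.cochain D 1 1) := by
  have h := S.map_iso D (mul_one g)
  rw [D.iso_one_right, S.map_comp, S.map_whiskerLeft, S.map_rightUnitor_hom, D.mk_obj] at h
  rw [← map_eqToHom_obj_one, map_mul]
  apply Additive.ofMul.injective
  replace h := congrArg Additive.ofMul h
  simp only [ofMul_mul, ofMul_inv] at *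
  grind

variable {α : Pi0 G → Pi0 G → Pi0 G → Pi1 G} {D} (hD : D.cocycle = α)

/-- The data `(ρ, β, c)` of the scalars `S`. The cochain `S.cochain D` is normalized by subtracting
`g ↦ g · z`, where `z` is its value at `(e, e)`; this is the coboundary of a constant 1-cochain. -/
def repData : RepData α n where
  ρ := S.perm
  β := S.character
  β_smul g u := S.character_smul g u
  c g h := S.cochain D g h * (coordPerm (S.perm g) (S.cochain D 1 1))⁻¹
  c_normalized :=
    { one_left := fun g => by
        rw [S.cochain_one_left, map_one, coordPerm_one, mul_inv_cancel]
      one_right := fun g => by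
        rw [S.cochain_one_right, mul_inv_cancel] }
  coboundary_c g h k := by
    rw [← hD, ← S.coboundary_cochain, coboundary₂, coboundary₂]
    simp only [permAct_eq_coordPerm, map_mul, _root_.map_inv, coordPerm_mul]
    apply Additive.ofMul.injective
    simp only [ofMul_mul, ofMul_inv]
    grind

end ScalarRep

/-- Equivalence of data of possibly different dimensions `n` and `n'`, by a bijection `σ` of the
coordinates. -/
def RepData.EquivalentVia {α : Pi0 G → Pi0 G → Pi0 G → Pi1 G} {n n' : ℕ} (q : RepData α n)
    (q' : RepData α n') (σ : Fin n ≃ Fin n') : Prop :=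
  (∀ g, (q.ρ g).trans σ = σ.trans (q'.ρ g)) ∧
    (∀ u, q'.β u = coordPerm σ (q.β u)) ∧
    ∃ x : Pi0 G → Fin n' → ℂˣ, x 1 = 1 ∧
      ∀ g h, q'.c g h = coordPerm σ (q.c g h) * coboundary₁ (fun g => permAct (q'.ρ g)) x g h

lemma Quadruple.equivalent_iff {α : Pi0 G → Pi0 G → Pi0 G → Pi1 G} (Q Q' : Quadruple α) :
    Q.Equivalent Q' ↔ ∃ σ, Q.data.EquivalentVia Q'.data σ := by
  have key {n : ℕ} (q q' : RepData α n) (σ : Equiv.Perm (Fin n)) :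
      (∀ g, q'.ρ g = σ * q.ρ g * σ⁻¹) ↔ ∀ g, (q.ρ g).trans σ = σ.trans (q'.ρ g) :=
    forall_congr' fun g => by
      rw [eq_mul_inv_iff_mul_eq]
      exact eq_comm
  constructor
  · rintro ⟨pos, q, q', σ, h1, h2, h3⟩
    exact ⟨σ, (key _ _ _).1 h1, h2, h3⟩
  · obtain ⟨n, pos, q⟩ := Q
    obtain ⟨n', pos', q'⟩ := Q'
    rintro ⟨σ, h1, h2, h3⟩
    obtain rfl : n = n' := Fin.equiv_iff_eq.1 ⟨σ⟩
    exact .mk pos q q' ⟨σ, (key _ _ _).2 h1, h2, h3⟩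

namespace ScalarRep

variable {n n' : ℕ} {S : ScalarRep G n} {S' : ScalarRep G n'} {D : SkeletonData G}
  {α : Pi0 G → Pi0 G → Pi0 G → Pi1 G} (hD : D.cocycle = α)

lemma Equivalence.equivalentVia (E : Equivalence S S') :
    (S.repData hD).EquivalentVia (S'.repData hD) E.σ := by
  have hc (g h : Pi0 G) : coordPerm E.σ (S.cochain D g h) * E.x (D.obj (g * h)) =
      E.x (D.obj g) * coordPerm (S'.perm g) (E.x (D.obj h)) * S'.cochain D g h := by
    have h1 := E.naturality (D.iso (g := g) (h := h) rfl).hom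
    have h2 := E.tensor (D.obj g) (D.obj h)
    rw [map_iso, map_iso, map_mul] at h1
    rw [D.mk_obj] at h2
    apply Additive.ofMul.injective
    replace h1 := congrArg Additive.ofMul h1
    replace h2 := congrArg Additive.ofMul h2
    simp only [ofMul_mul] at *
    grind
  have h1 := hc 1 1
  rw [map_one, coordPerm_one, one_mul] at h1
  refine ⟨E.perm_comm, fun u => ?_, fun g => (E.x (D.obj g))⁻¹ *
    (coordPerm E.σ (S.cochain D 1 1) * (S'.cochain D 1 1)⁻¹), ?_, fun g h => ?_⟩
  · have h := E.naturality u.hom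
    rw [mul_comm] at h
    exact (mul_left_cancel h).symm
  · apply Additive.ofMul.injective
    replace h1 := congrArg Additive.ofMul h1
    simp only [ofMul_mul, ofMul_inv, ofMul_one] at *
    grind
  · have h2 := hc g h
    simp only [repData, coboundary₁, permAct_eq_coordPerm, map_mul, _root_.map_inv,
      E.coordPerm_comm]
    apply Additive.ofMul.injective
    replace h2 := congrArg Additive.ofMul h2
    simp only [ofMul_mul, ofMul_inv] at *
    grind

/-- The representation is determined up to equivalence by its restriction to the representatives
`A_g`: the scalars at an arbitrary object `A` are transported along `A ≅ A_g`. -/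
lemma exists_equivalence {σ : Fin n ≃ Fin n'}
    (h : (S.repData hD).EquivalentVia (S'.repData hD) σ) : Nonempty (Equivalence S S') := by
  obtain ⟨hρ, hβ, y, -, hc⟩ := h
  change ∀ g, (S.perm g).trans σ = σ.trans (S'.perm g) at hρ
  change ∀ u, S'.character u = coordPerm σ (S.character u) at hβ
  have comm (g : Pi0 G) (l : Fin n → ℂˣ) :
      coordPerm σ (coordPerm (S.perm g) l) = coordPerm (S'.perm g) (coordPerm σ l) := by
    rw [← coordPerm_trans, hρ, coordPerm_trans]
  let t (g : Pi0 G) : Fin n' → ℂˣ :=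
    (y g * (S'.cochain D 1 1 * (coordPerm σ (S.cochain D 1 1))⁻¹))⁻¹
  have ht (g h : Pi0 G) : coordPerm σ (S.cochain D g h) * t (g * h) =
      t g * coordPerm (S'.perm g) (t h) * S'.cochain D g h := by
    have h2 := hc g h
    simp only [repData, coboundary₁, permAct_eq_coordPerm, map_mul, _root_.map_inv, comm] at h2
    simp only [t, map_mul, _root_.map_inv]
    apply Additive.ofMul.injective
    replace h2 := congrArg Additive.ofMul h2
    simp only [ofMul_mul, ofMul_inv] at *
    grind
  let x (A : G) : Fin n' → ℂˣ := coordPerm σ (S.map (D.frame A rfl).hom) * t (Pi0.mk A) *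
    (S'.map (D.frame A rfl).hom)⁻¹
  -- The isomorphism `A ≅ A_g` may be replaced by any other one.
  have hx {A : G} {g : Pi0 G} (hA : Pi0.mk A = g) (f : A ⟶ D.obj g) :
      x A * S'.map f = coordPerm σ (S.map f) * t g := by
    subst hA
    rw [S.map_eq_character_mul f (D.frame A rfl).hom, S'.map_eq_character_mul f (D.frame A rfl).hom,
      map_mul, hβ]
    simp only [x]
    apply Additive.ofMul.injective
    simp only [ofMul_mul, ofMul_inv]
    grind
  refine ⟨⟨σ, x, hρ, fun {A B} φ => ?_, fun A B => ?_⟩⟩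
  · have h1 := hx (Pi0.mk_eq_of_hom φ) (φ ≫ (D.frame B rfl).hom)
    have h2 := hx rfl (D.frame B rfl).hom
    rw [map_comp, map_comp, map_mul] at h1
    apply Additive.ofMul.injective
    replace h1 := congrArg Additive.ofMul h1
    replace h2 := congrArg Additive.ofMul h2
    simp only [ofMul_mul] at *
    grind
  · have h1 := hx (Pi0.mk_tensor A B) (D.tensorFrame (A := A) (B := B) rfl rfl rfl).hom
    have h2 := ht (Pi0.mk A) (Pi0.mk B)
    have hA := hx rfl (D.frame A rfl).hom
    have hB := congrArg (coordPerm (S'.perm (Pi0.mk A))) (hx rfl (D.frame B rfl).hom)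
    simp only [map_tensorFrame, map_mul, comm] at h1 hB
    apply Additive.ofMul.injective
    replace h1 := congrArg Additive.ofMul h1
    replace h2 := congrArg Additive.ofMul h2
    replace hA := congrArg Additive.ofMul hA
    replace hB := congrArg Additive.ofMul hB
    simp only [ofMul_mul] at *
    grind

lemma nonempty_equivalence_iff :
    Nonempty (Equivalence S S') ↔ ∃ σ, (S.repData hD).EquivalentVia (S'.repData hD) σ :=
  ⟨fun ⟨E⟩ => ⟨E.σ, E.equivalentVia hD⟩, fun ⟨_, h⟩ => exists_equivalence hD h⟩

end ScalarRep

end Cochains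

/-! ### Coordinates of the morphisms of a 2-group with respect to a choice -/

section RepresentationOfData

open MonoidalCategory

variable {G : Type u} [Category.{v} G] [MonoidalCategory G] [IsTwoGroup G]

namespace SkeletonData

variable (D : SkeletonData G)

lemma tensorFrame_unit_left (A : G) {g : Pi0 G} (hA : Pi0.mk A = g) :
    (D.tensorFrame Pi0.mk_unit hA (one_mul g)).hom = (λ_ A).hom ≫ (D.frame A hA).hom := by
  rw [tensorFrame_hom', frame_unit, iso_one_left, eqToIso.hom, ← comp_whiskerRight_assoc,
    eqToHom_trans, eqToHom_refl, id_whiskerRight, Category.id_comp, leftUnitor_naturality]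

lemma tensorFrame_unit_right (A : G) {g : Pi0 G} (hA : Pi0.mk A = g) :
    (D.tensorFrame hA Pi0.mk_unit (mul_one g)).hom = (ρ_ A).hom ≫ (D.frame A hA).hom := by
  rw [tensorFrame_hom, frame_unit, iso_one_right, eqToIso.hom, ← whiskerLeft_comp_assoc,
    eqToHom_trans, eqToHom_refl, whiskerLeft_id, Category.id_comp, rightUnitor_naturality]

/-- The class in `π₁(G)` of the difference between `A ⊗ B ≅ A_g ⊗ A_h ≅ A_{gh}` and the chosen
isomorphism `A ⊗ B ≅ A_{gh}`. -/
def tensorDiff (A B : G) : Pi1 G :=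
  homDiff (D.tensorFrame (A := A) (B := B) rfl rfl rfl).hom (D.frame (A ⊗ B) rfl).hom

lemma tensorDiff_eq {A B : G} {g h k : Pi0 G} (hA : Pi0.mk A = g) (hB : Pi0.mk B = h)
    (hk : g * h = k) (hAB : Pi0.mk (A ⊗ B) = k) :
    D.tensorDiff A B = homDiff (D.tensorFrame hA hB hk).hom (D.frame (A ⊗ B) hAB).hom := by
  subst hA hB hk
  rfl

/-- The class in `π₁(G)` of a morphism `φ : A ⟶ B` with respect to the chosen isomorphisms of `A` and
`B` with the representative of their class. -/
def homClass {A B : G} (φ : A ⟶ B) : Pi1 G :=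
  homDiff (φ ≫ (D.frame B rfl).hom) (D.frame A (Pi0.mk_eq_of_hom φ)).hom

lemma homClass_eq {A B : G} (φ : A ⟶ B) {g : Pi0 G} (hA : Pi0.mk A = g) (hB : Pi0.mk B = g) :
    D.homClass φ = homDiff (φ ≫ (D.frame B hB).hom) (D.frame A hA).hom := by
  subst hB
  rfl

lemma homClass_id (A : G) : D.homClass (𝟙 A) = 1 := by
  rw [homClass, Category.id_comp, homDiff_self]

lemma homClass_comp {A B C : G} (φ : A ⟶ B) (ψ : B ⟶ C) :
    D.homClass (φ ≫ ψ) = D.homClass φ * D.homClass ψ := by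
  have hB := Pi0.mk_eq_of_hom ψ
  have hA := (Pi0.mk_eq_of_hom φ).trans hB
  rw [D.homClass_eq (φ ≫ ψ) hA rfl, D.homClass_eq φ hA hB, D.homClass_eq ψ hB rfl, mul_comm,
    ← homDiff_comp_left φ, homDiff_mul, Category.assoc]

lemma homClass_inv {A B : G} (e : A ≅ B) : D.homClass e.inv = (D.homClass e.hom)⁻¹ := by
  rw [eq_inv_iff_mul_eq_one, ← homClass_comp, e.inv_hom_id, homClass_id]

lemma homClass_aut (g : Pi0 G) (φ : Aut (D.obj g)) :
    D.homClass φ.hom = (gamma (D.obj g)).symm φ := by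
  rw [D.homClass_eq φ.hom (D.mk_obj g) (D.mk_obj g), frame_obj, Iso.refl_hom, Category.comp_id,
    homDiff_aut]

lemma homClass_whiskerLeft (A : G) {B B' : G} (φ : B ⟶ B') :
    D.homClass (A ◁ φ) = (D.tensorDiff A B) * Pi0.mk A • D.homClass φ * (D.tensorDiff A B')⁻¹ := by
  have hB := Pi0.mk_eq_of_hom φ
  have hAB : Pi0.mk (A ⊗ B) = Pi0.mk A * Pi0.mk B' := Pi0.mk_eq_of_hom (A ◁ φ)
  rw [D.homClass_eq (A ◁ φ) hAB (Pi0.mk_tensor A B'), D.homClass_eq φ hB rfl,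
    D.tensorDiff_eq rfl hB rfl hAB, D.tensorDiff_eq rfl rfl rfl (Pi0.mk_tensor A B'),
    homDiff_inv, ← homDiff_whiskerLeft, ← homDiff_comp_left (A ◁ φ),
    ← homDiff_comp_right (A ◁ (φ ≫ _)) _ ((D.frame A rfl).hom ▷ D.obj (Pi0.mk B') ≫ (D.iso rfl).hom),
    ← tensorFrame_hom', MonoidalCategory.whiskerLeft_comp, Category.assoc, ← tensorFrame_hom',
    mul_comm, mul_comm (homDiff (D.tensorFrame rfl hB rfl).hom _), homDiff_mul, homDiff_mul]

lemma homClass_whiskerRight {A A' : G} (φ : A ⟶ A') (B : G) :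
    D.homClass (φ ▷ B) = (D.tensorDiff A B) * D.homClass φ * (D.tensorDiff A' B)⁻¹ := by
  have hA := Pi0.mk_eq_of_hom φ
  have hAB : Pi0.mk (A ⊗ B) = Pi0.mk A' * Pi0.mk B := Pi0.mk_eq_of_hom (φ ▷ B)
  rw [D.homClass_eq (φ ▷ B) hAB (Pi0.mk_tensor A' B), D.homClass_eq φ hA rfl,
    D.tensorDiff_eq hA rfl rfl hAB, D.tensorDiff_eq rfl rfl rfl (Pi0.mk_tensor A' B),
    homDiff_inv, ← homDiff_whiskerRight (φ ≫ _) _ B, ← homDiff_comp_left (φ ▷ B),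
    ← homDiff_comp_right ((φ ≫ _) ▷ B) _ (D.obj (Pi0.mk A') ◁ (D.frame B rfl).hom ≫ (D.iso rfl).hom),
    ← tensorFrame_hom, MonoidalCategory.comp_whiskerRight, Category.assoc, ← tensorFrame_hom,
    mul_comm, mul_comm (homDiff (D.tensorFrame hA rfl rfl).hom _), homDiff_mul, homDiff_mul]

lemma homClass_leftUnitor_hom (A : G) : D.homClass (λ_ A).hom = D.tensorDiff (𝟙_ G) A := by
  have hA : Pi0.mk (𝟙_ G ⊗ A) = Pi0.mk A := Pi0.mk_eq_of_hom (λ_ A).hom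
  rw [D.homClass_eq _ hA rfl, D.tensorDiff_eq Pi0.mk_unit rfl (one_mul _) hA,
    tensorFrame_unit_left]

lemma homClass_rightUnitor_hom (A : G) : D.homClass (ρ_ A).hom = D.tensorDiff A (𝟙_ G) := by
  have hA : Pi0.mk (A ⊗ 𝟙_ G) = Pi0.mk A := Pi0.mk_eq_of_hom (ρ_ A).hom
  rw [D.homClass_eq _ hA rfl, D.tensorDiff_eq rfl Pi0.mk_unit (mul_one _) hA,
    tensorFrame_unit_right]

/-- Both products `(A ⊗ B) ⊗ C` and `A ⊗ (B ⊗ C)` are compared with `A_{ghk}` in two steps; the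
3-cocycle appears through the associator of the representatives. -/
lemma homClass_associator_hom (A B C : G) :
    D.homClass (α_ A B C).hom * (Pi0.mk A • D.tensorDiff B C * D.tensorDiff A (B ⊗ C)) =
      D.cocycle (Pi0.mk A) (Pi0.mk B) (Pi0.mk C) *
        (D.tensorDiff A B * D.tensorDiff (A ⊗ B) C) := by
  have hl : Pi0.mk ((A ⊗ B) ⊗ C) = Pi0.mk A * Pi0.mk B * Pi0.mk C := rfl
  have hr : Pi0.mk (A ⊗ B ⊗ C) = Pi0.mk A * Pi0.mk B * Pi0.mk C := 
    (mul_assoc (Pi0.mk A) (Pi0.mk B) (Pi0.mk C)).symm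
  have hBC : Pi0.mk (B ⊗ C) = Pi0.mk B * Pi0.mk C := rfl
  have hAB : Pi0.mk (A ⊗ B) = Pi0.mk A * Pi0.mk B := rfl
  have hm := (mul_assoc (Pi0.mk A) (Pi0.mk B) (Pi0.mk C)).symm
  -- The isomorphism `A ⊗ (B ⊗ C) ≅ A_g ⊗ (A_h ⊗ A_k) ≅ A_{ghk}`.
  have e1 : homDiff (A ◁ (D.tensorFrame (A := B) (B := C) rfl rfl rfl).hom ≫
      (D.frame A rfl).hom ▷ _ ≫ (D.iso hm).hom) (D.frame (A ⊗ B ⊗ C) hr).hom =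
      Pi0.mk A • D.tensorDiff B C * D.tensorDiff A (B ⊗ C) := by
    rw [D.tensorDiff_eq rfl hBC hm hr, D.tensorDiff_eq rfl rfl rfl hBC, ← homDiff_whiskerLeft,
      ← homDiff_comp_right (A ◁ _) _ ((D.frame A rfl).hom ▷ _ ≫ (D.iso hm).hom),
      ← tensorFrame_hom', homDiff_mul]
  -- The isomorphism `(A ⊗ B) ⊗ C ≅ (A_g ⊗ A_h) ⊗ A_k ≅ A_{ghk}`.
  have e2 : homDiff ((D.tensorFrame (A := A) (B := B) rfl rfl rfl).hom ▷ C ≫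
      _ ◁ (D.frame C rfl).hom ≫ (D.iso rfl).hom) (D.frame ((A ⊗ B) ⊗ C) hl).hom =
      D.tensorDiff A B * D.tensorDiff (A ⊗ B) C := by
    rw [D.tensorDiff_eq hAB rfl rfl hl, D.tensorDiff_eq rfl rfl rfl hAB,
      ← homDiff_whiskerRight (D.tensorFrame rfl rfl rfl).hom _ C,
      ← homDiff_comp_right ((D.tensorFrame (A := A) (B := B) rfl rfl rfl).hom ▷ C) _ (_ ◁ (D.frame C rfl).hom ≫ (D.iso rfl).hom),
      ← tensorFrame_hom, homDiff_mul]
  -- By naturality of the associator, `A`, `B`, `C` may be replaced by `A_g`, `A_h`, `A_k`.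
  have e3 : homDiff ((α_ A B C).hom ≫ A ◁ (D.tensorFrame (A := B) (B := C) rfl rfl rfl).hom ≫
      (D.frame A rfl).hom ▷ _ ≫ (D.iso hm).hom)
      ((D.tensorFrame (A := A) (B := B) rfl rfl rfl).hom ▷ C ≫
        _ ◁ (D.frame C rfl).hom ≫ (D.iso rfl).hom) =
      D.cocycle (Pi0.mk A) (Pi0.mk B) (Pi0.mk C) := by
    rw [D.cocycle_eq_homDiff _ _ _ rfl rfl rfl hm]
    rw [← homDiff_comp_left (((D.frame A rfl).hom ⊗ₘ (D.frame B rfl).hom) ⊗ₘ (D.frame C rfl).hom)]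
    congr 1
    · rw [MonoidalCategory.whisker_exchange_assoc]
      simp [tensorFrame_hom, MonoidalCategory.tensorHom_def]
    · rw [tensorFrame_hom]
      simp only [MonoidalCategory.comp_whiskerRight, Category.assoc]
      rw [← MonoidalCategory.whisker_exchange_assoc]
      simp [MonoidalCategory.tensorHom_def]
  rw [← e1, ← e2, ← e3, D.homClass_eq _ hl hr, homDiff_mul, mul_comm, ← homDiff_comp_left (α_ A B C).hom,
    homDiff_mul]

end SkeletonData

end RepresentationOfData

/-! ### Representations with given data, and the classification -/

section Classification

open MonoidalCategory

variable {G : Type u} [Category.{v} G] [MonoidalCategory G] [IsTwoGroup G]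
  {α : Pi0 G → Pi0 G → Pi0 G → Pi1 G} {D : SkeletonData G}

lemma coordPerm_β {n : ℕ} (q : RepData α n) (A : G) (u : Pi1 G) :
    coordPerm (q.ρ (Pi0.mk A)) (q.β u) = q.β (Pi0.mk A • u) := (q.β_smul _ u).symm

/-- The scalars of the representation with data `(ρ, β, c)`: those of the representation of the
skeleton of `G`, transported along the chosen isomorphisms `A ≅ A_g`. -/
def RepData.scalarRep (hD : D.cocycle = α) {n : ℕ} (q : RepData α n) : ScalarRep G n where
  perm := q.ρ
  map φ := q.β (D.homClass φ)
  mul A B := (q.c (Pi0.mk A) (Pi0.mk B))⁻¹ * q.β (D.tensorDiff A B)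
  unit := 1
  map_id A := by rw [D.homClass_id, map_one]
  map_comp φ ψ := by rw [D.homClass_comp, map_mul]
  map_whiskerLeft A {B B'} φ := by
    rw [D.homClass_whiskerLeft, coordPerm_β, Pi0.mk_eq_of_hom φ, map_mul, map_mul, map_inv]
    apply Additive.ofMul.injective
    simp only [ofMul_mul, ofMul_inv]
    grind
  map_whiskerRight {A A'} φ B := by
    rw [D.homClass_whiskerRight, Pi0.mk_eq_of_hom φ, map_mul, map_mul, map_inv]
    apply Additive.ofMul.injective
    simp only [ofMul_mul, ofMul_inv]
    grind
  map_associator_inv A B C := by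
    have h := congrArg q.β (D.homClass_associator_hom A B C)
    have h' := q.coboundary_c (Pi0.mk A) (Pi0.mk B) (Pi0.mk C)
    rw [coboundary₂, permAct_eq_coordPerm] at h'
    rw [hD] at h
    rw [D.homClass_inv]
    simp only [Pi0.mk_tensor, map_mul, map_inv, coordPerm_β] at h ⊢
    apply Additive.ofMul.injective
    replace h := congrArg Additive.ofMul h
    replace h' := congrArg Additive.ofMul h'
    simp only [ofMul_mul, ofMul_inv] at *
    grind
  map_leftUnitor_hom A := by
    rw [D.homClass_leftUnitor_hom, Pi0.mk_unit, q.c_normalized.one_left, inv_one, one_mul, mul_one]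
  map_rightUnitor_hom A := by
    rw [D.homClass_rightUnitor_hom, Pi0.mk_unit, q.c_normalized.one_right, inv_one, one_mul,
      map_one, mul_one]

lemma RepData.map_aut_scalarRep (hD : D.cocycle = α) {n : ℕ} (q : RepData α n) (g : Pi0 G)
    (φ : Aut (D.obj g)) : (q.scalarRep hD).map φ.hom = q.β ((gamma (D.obj g)).symm φ) :=
  congrArg q.β (D.homClass_aut g φ)

/-- The chosen isomorphisms are identities on the representatives, so that `β` does not contribute. -/
lemma RepData.cochain_scalarRep (hD : D.cocycle = α) {n : ℕ} (q : RepData α n) (g h : Pi0 G) :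
    (q.scalarRep hD).cochain D g h = q.c g h := by
  have e1 : D.tensorDiff (D.obj g) (D.obj h) = D.homClass (D.iso (g := g) (h := h) rfl).hom := by
    have hk : Pi0.mk (D.obj g ⊗ D.obj h) = g * h := by rw [Pi0.mk_tensor, D.mk_obj, D.mk_obj]
    rw [D.homClass_eq _ hk (D.mk_obj (g * h)), D.tensorDiff_eq (D.mk_obj g) (D.mk_obj h) rfl hk,
      SkeletonData.tensorFrame_hom, SkeletonData.frame_obj, SkeletonData.frame_obj,
      SkeletonData.frame_obj]
    simp
  have e2 : (q.scalarRep hD).mul (D.obj g) (D.obj h) =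
      (q.c g h)⁻¹ * q.β (D.tensorDiff (D.obj g) (D.obj h)) := by
    have : (q.scalarRep hD).mul (D.obj g) (D.obj h) =
      (q.c (Pi0.mk (D.obj g)) (Pi0.mk (D.obj h)))⁻¹ * q.β (D.tensorDiff (D.obj g) (D.obj h)) := rfl
    rw [this, D.mk_obj, D.mk_obj]
  have e3 : (q.scalarRep hD).map (D.iso (g := g) (h := h) rfl).hom =
      q.β (D.tensorDiff (D.obj g) (D.obj h)) := congrArg q.β e1.symm
  rw [ScalarRep.cochain, e2, e3, mul_inv, inv_inv, inv_mul_cancel_right]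

namespace SkeletonData

open TwoMat

variable (D)

/-- The isomorphism `ι_{g,h}` as a 2-morphism of the one-object bicategory of `G`. -/
def isoHom₂ (g h : Pi0 G) :
    Deloop.hom (D.obj h) ≫ Deloop.hom (D.obj g) ⟶ Deloop.hom (D.obj (g * h)) :=
  (D.iso (g := g) (h := h) rfl).hom

lemma structIso_eq (F : TwoMatRep G) (g h : Pi0 G) : D.structIso F g h =
    (F.mapComp (Deloop.hom (D.obj h)) (Deloop.hom (D.obj g))).inv ≫ F.map₂ (D.isoHom₂ g h) := rfl

instance (F : TwoMatRep G) (g h : Pi0 G) : IsIso (D.structIso F g h) := by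
  rw [structIso_eq]
  infer_instance

lemma coefUnit_structIso (F : TwoMatRep G) (g h : Pi0 G) :
    coefUnit (D.structIso F g h) = F.scalarRep.cochain D g h := by
  rw [structIso_eq, coefUnit_comp, coefUnit_iso_inv]
  rfl

lemma realizesData_iff (F : TwoMatRep G) (q : RepData α F.dim) :
    D.RealizesData F q ↔
      (∀ g, F.map (Deloop.hom (D.obj g)) = TwoMat.permHom (q.ρ g)) ∧
      (∀ (g : Pi0 G) (φ : Aut (D.obj g)),
        F.scalarRep.map φ.hom = q.β ((gamma (D.obj g)).symm φ)) ∧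
      ∀ g h, F.scalarRep.cochain D g h = q.c g h := by
  have hp (hm : ∀ g, F.map (Deloop.hom (D.obj g)) = TwoMat.permHom (q.ρ g)) (g : Pi0 G) :
      IsPerm (F.map (Deloop.hom (D.obj g))) (q.ρ g) := by
    rw [hm]
    exact isPerm_ofEquiv _
  have hp₂ (hm : ∀ g, F.map (Deloop.hom (D.obj g)) = TwoMat.permHom (q.ρ g)) (g h : Pi0 G) :
      IsPerm (F.map (Deloop.hom (D.obj h)) ≫ F.map (Deloop.hom (D.obj g))) (q.ρ (g * h)) := by
    rw [map_mul]
    exact (hp hm h).comp (hp hm g)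
  constructor
  · rintro ⟨h1, h2, h3⟩
    refine ⟨h1, fun g φ => ?_, fun g h => ?_⟩
    · exact (forall_entry_eq_iff (hp h1 g) _ _).1 (h2 g φ)
    · rw [← coefUnit_structIso]
      exact (forall_entry_eq_iff (hp₂ h1 g h) _ _).1 (h3 g h)
  · rintro ⟨h1, h2, h3⟩
    refine ⟨h1, fun g φ => ?_, fun g h => ?_⟩
    · exact (forall_entry_eq_iff (hp h1 g) _ _).2 (h2 g φ)
    · have h4 := h3 g h
      rw [← coefUnit_structIso] at h4
      exact (forall_entry_eq_iff (hp₂ h1 g h) _ _).2 h4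

variable {D}

/-- A gauge trivial representation determines its data. -/
lemma RealizesData.eq_repData (hD : D.cocycle = α) {F : TwoMatRep G} {q : RepData α F.dim}
    (h : D.RealizesData F q) : q = F.scalarRep.repData hD := by
  obtain ⟨h1, h2, h3⟩ := (D.realizesData_iff F q).1 h
  have hρ : q.ρ = F.perm := by
    ext1 g
    have e := F.isPerm_map (D.obj g)
    rw [h1, D.mk_obj] at e
    exact (isPerm_ofEquiv _).unique e
  have hβ : q.β = F.scalarRep.character := by
    ext1 u
    have e := h2 1 (gammaHom (D.obj 1) u)
    rw [F.scalarRep.map_gammaHom] at e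
    rw [e]
    exact congrArg q.β ((gamma (D.obj 1)).symm_apply_apply u).symm
  have hc : q.c = fun g h => F.scalarRep.cochain D g h *
      (coordPerm (F.scalarRep.perm g) (F.scalarRep.cochain D 1 1))⁻¹ := by
    funext g h
    rw [h3, h3, q.c_normalized.one_left, map_one, inv_one, mul_one]
  obtain ⟨ρ, β, _, c, _, _⟩ := q
  dsimp only at hρ hβ hc
  subst hρ hβ hc
  rfl

lemma realizesData_toRep (hD : D.cocycle = α) {n : ℕ} (q : RepData α n) :
    D.RealizesData (q.scalarRep hD).toRep q := by
  have hmap {A B : G} (φ : A ⟶ B) :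
      (q.scalarRep hD).toRep.scalarRep.map φ = (q.scalarRep hD).map φ :=
    (q.scalarRep hD).coefUnit_iso₂ φ
  have hmul (A B : G) :
      (q.scalarRep hD).toRep.scalarRep.mul A B = (q.scalarRep hD).mul A B :=
    (q.scalarRep hD).coefUnit_isoMul A B
  refine (realizesData_iff _ _ _).2 ⟨fun g => ?_, fun g φ => ?_, fun g h => ?_⟩
  · have h : (q.scalarRep hD).toRep.map (Deloop.hom (D.obj g)) =
      TwoMat.permHom (n := ⟨n⟩) (q.ρ (Pi0.mk (D.obj g))) := rfl
    rw [h, D.mk_obj]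
    rfl
  · exact (hmap φ.hom).trans (q.map_aut_scalarRep hD g φ)
  · rw [← q.cochain_scalarRep hD, ScalarRep.cochain, ScalarRep.cochain]
    exact congrArg₂ (fun x y => x⁻¹ * y) (hmul _ _) (hmap _)

end SkeletonData

/-- The quadruple of a nonzero representation. -/
def NonzeroRep.quadruple (hD : D.cocycle = α) (F : NonzeroRep G) : Quadruple α :=
  ⟨F.1.dim, F.2, F.1.scalarRep.repData hD⟩

open scoped Pseudofunctor.StrongTrans in
lemma NonzeroRep.quadruple_equivalent_iff (hD : D.cocycle = α) (F F' : NonzeroRep G) :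
    (F.quadruple hD).Equivalent (F'.quadruple hD) ↔ AreEquivalent F.1 F'.1 := by
  rw [TwoMatRep.areEquivalent_iff, ScalarRep.nonempty_equivalence_iff hD,
    Quadruple.equivalent_iff]
  rfl

lemma SkeletonData.Realizes.eq_quadruple (hD : D.cocycle = α) {Q : Quadruple α} {F : NonzeroRep G}
    (h : D.Realizes Q F) : Q = F.quadruple hD := by
  obtain ⟨q, rfl, hq⟩ := h
  rw [hq.eq_repData hD]
  rfl

lemma SkeletonData.exists_realizes (hD : D.cocycle = α) (Q : Quadruple α) :
    ∃ F : NonzeroRep G, D.Realizes Q F :=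
  ⟨⟨(Q.data.scalarRep hD).toRep, Q.pos⟩, Q.data, rfl, realizesData_toRep hD Q.data⟩

/-- The classification of nonzero representations by their quadruples. -/
def NonzeroRep.classEquiv (hD : D.cocycle = α) :
    Quotient (NonzeroRep.setoid G) ≃ Quotient (Quadruple.setoid α) :=
  Equiv.ofBijective
    (Quotient.map (sa := NonzeroRep.setoid G) (sb := Quadruple.setoid α)
      (NonzeroRep.quadruple hD) fun F F' => (quadruple_equivalent_iff hD F F').2)
    (by
      constructor
      · intro x y
        induction x, y using Quotient.inductionOn₂ with
        | _ F F' =>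
        intro h
        exact Quotient.sound (s := NonzeroRep.setoid G)
          ((quadruple_equivalent_iff hD F F').1 (Quotient.exact (s := Quadruple.setoid α) h))
      · intro y
        induction y using Quotient.inductionOn with
        | _ Q =>
        obtain ⟨F, hF⟩ := D.exists_realizes hD Q
        exact ⟨Quotient.mk _ F, congrArg (Quotient.mk _) (hF.eq_quadruple hD).symm⟩)

end Classification

end
theorem mainTheorem1 {G : Type u} [Category.{v} G] [MonoidalCategory G] [IsTwoGroup G]
    (α : Pi0 G → Pi0 G → Pi0 G → Pi1 G) (hα : IsClassifyingCocycle α) :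
    (∃ D : SkeletonData G, D.cocycle = α) ∧
    ∀ D : SkeletonData G, D.cocycle = α →
      ∃ Φ : Quotient (Quadruple.setoid α) ≃ Quotient (NonzeroRep.setoid G),
        ∀ Q : Quadruple α, (∃ F : NonzeroRep G, D.Realizes Q F) ∧
          ∀ F : NonzeroRep G, D.Realizes Q F →
            Φ (Quotient.mk (Quadruple.setoid α) Q) = Quotient.mk (NonzeroRep.setoid G) F := by
  refine ⟨SkeletonData.exists_cocycle_eq hα, fun D hD => ⟨(NonzeroRep.classEquiv hD).symm,
    fun Q => ⟨D.exists_realizes hD Q, fun F hF => ?_⟩⟩⟩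
  rw [Equiv.symm_apply_eq, hF.eq_quadruple hD]
  rfl
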